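/- Let $n\ge 3$. Let $\mathfrak{o}(n,\mathbb{C})$ be the Lie algebra of skew-symmetric complex $n\times n$ matrices and let $\mathfrak{e}_n^{\mathbb{C}}=\mathfrak{o}(n,\mathbb{C})\ltimes\mathbb{C}^n$ be the complexified Euclidean Lie algebra, where $\mathbb{C}^n$ is an abelian ideal on which $\mathfrak{o}(n,\mathbb{C})$ acts in the standard way. Let $\mathbf{e}_1,\dots,\mathbf{e}_n$ be the standard basis of $\mathbb{C}^n$ and let $\mathbf{l}_{ij}=-\mathbf{l}_{ji}\in\mathfrak{o}(n,\mathbb{C})$ be the matrices with $[\mathbf{l}_{ij},\mathbf{e}_k]=\mathbf{l}_{ij}\mathbf{e}_k=\delta_{ik}\mathbf{e}_j-\delta_{jk}\mathbf{e}_i$. Let $f:\mathbb{C}^n\times\mathbb{C}^n\to\mathfrak{e}_n^{\mathbb{C}}$ be the alternating bilinear map with $f(\mathbf{e}_i,\mathbf{e}_j)=\mathbf{l}_{ij}$, and let $F:\mathfrak{e}_n^{\mathbb{C}}\times\mathfrak{e}_n^{\mathbb{C}}\to\mathfrak{e}_n^{\mathbb{C}}$ be the bilinear map that extends $f$ and vanishes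 whenever one argument lies in $\mathfrak{o}(n,\mathbb{C})$. 1. The map $f$ is a 2-cocycle of $\mathbb{C}^n$ with values in $\mathfrak{e}_n^{\mathbb{C}}$, that is, $[u,f(v,w)]-[v,f(u,w)]+[w,f(u,v)]=0$ for all $u,v,w\in\mathbb{C}^n$. It is invariant, in the sense that for every $g\in\mathfrak{o}(n,\mathbb{C})$ the map $(u,v)\mapsto[g,f(u,v)]-f([g,u],v)-f(u,[g,v])$ is a 2-coboundary, i.e. of the form $(u,v)\mapsto[l(u),v]+[u,l(v)]$ with $l:\mathbb{C}^n\to\mathfrak{e}_n^{\mathbb{C}}$ linear. It is not a 2-coboundary, and every invariant 2-cocycle of $\mathbb{C}^n$ with values in $\mathfrak{e}_n^{\mathbb{C}}$ is the sum of a complex multiple of $f$ and a 2-coboundary. 2. The map $F$ is a 2-cocycle of $\mathfrak{e}_n^{\mathbb{C}}$ with values in the adjoint module. The space of infinitesimal deformations $H^2(\mathfrak{e}_n^{\mathbb{C}},\mathfrak{e}_n^{\mathbb{C}})$ is one-dimensional and is spanned by the class of $F$. 3. Every infinitesimal deformation is integrable: for every 2-cocycle $\varphi$ of $\mathfrak{e}_n^{\mathbb{C}}$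 with values in the adjoint module there are alternating bilinear maps $\varphi_k:\mathfrak{e}_n^{\mathbb{C}}\times\mathfrak{e}_n^{\mathbb{C}}\to\mathfrak{e}_n^{\mathbb{C}}$, $k\ge 0$, with $\varphi_0=[\cdot,\cdot]$ and $\varphi_1=\varphi$, such that $\sum_{k\ge 0}t^k\varphi_k$ satisfies the Jacobi identity as a formal power series in $t$. 4. For every $\varepsilon\in\mathbb{C}$ the bracket $[x,y]_\varepsilon=[x,y]+\varepsilon F(x,y)$, i.e. the one with $[\mathbf{e}_i,\mathbf{e}_j]_\varepsilon=\varepsilon\,\mathbf{l}_{ij}$ and all other brackets of basis elements unchanged, is alternating and satisfies the Jacobi identity, so it defines a Lie algebra $\mathfrak{e}_n^{\mathbb{C}}(\varepsilon)$. If $\varepsilon\ne 0$, then $\mathfrak{e}_n^{\mathbb{C}}(\varepsilon)\cong\mathfrak{o}(n+1,\mathbb{C})$ as complex Lie algebras. -/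

import Mathlib

open LieModule.Cohomology

noncomputable section

/-- The vector space `ℂⁿ`, regarded as an abelian Lie algebra. -/
def TransAlg (n : ℕ) : Type := Fin n → ℂ

namespace TransAlg

instance (n : ℕ) : AddCommGroup (TransAlg n) := inferInstanceAs (AddCommGroup (Fin n → ℂ))

instance (n : ℕ) : Module ℂ (TransAlg n) := inferInstanceAs (Module ℂ (Fin n → ℂ))

instance (n : ℕ) : LieRing (TransAlg n) where
  bracket _ _ := 0
  add_lie _ _ _ := (add_zero 0).symm
  lie_add _ _ _ := (add_zero 0).symm
  lie_self _ := rfl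
  leibniz_lie _ _ _ := (add_zero 0).symm

theorem lie_eq_zero {n : ℕ} (u v : TransAlg n) : ⁅u, v⁆ = 0 := rfl

instance (n : ℕ) : LieAlgebra ℂ (TransAlg n) where
  lie_smul t _ _ := (smul_zero t).symm

end TransAlg

/-- The coordinates on the Lie algebra `ℂⁿ`. -/
def transCoord (n : ℕ) : TransAlg n ≃ₗ[ℂ] (Fin n → ℂ) := LinearEquiv.refl ℂ (Fin n → ℂ)

/-- The standard basis vector `eᵢ` of `ℂⁿ`. -/
def eVec {n : ℕ} (i : Fin n) : TransAlg n := (transCoord n).symm (Pi.single i 1)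

/-- The Lie algebra `𝔬(n, ℂ)` of skew-symmetric complex `n × n` matrices. -/
abbrev OrthAlg (n : ℕ) : Type := LieAlgebra.Orthogonal.so (Fin n) ℂ

/-- The standard action of `𝔬(n, ℂ)` on `ℂⁿ`, `A ↦ (u ↦ A u)`, by derivations of the abelian Lie
algebra `ℂⁿ`. -/
def rotationAction (n : ℕ) : OrthAlg n →ₗ⁅ℂ⁆ LieDerivation ℂ (TransAlg n) (TransAlg n) where
  toFun A :=
    { toLinearMap := (transCoord n).symm.toLinearMap ∘ₗ
        Matrix.mulVecLin (A : Matrix (Fin n) (Fin n) ℂ) ∘ₗ (transCoord n).toLinearMap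
      leibniz' := fun a b => by
        rw [TransAlg.lie_eq_zero, TransAlg.lie_eq_zero, TransAlg.lie_eq_zero, map_zero, sub_zero] }
  map_add' A B := by
    ext u
    exact Matrix.add_mulVec A.1 B.1 (transCoord n u)
  map_smul' t A := by
    ext u
    exact Matrix.smul_mulVec t A.1 (transCoord n u)
  map_lie' := by
    intro A B
    ext u
    rw [LieDerivation.lie_apply]
    change (A.1 * B.1 - B.1 * A.1).mulVec (transCoord n u)
      = A.1.mulVec (B.1.mulVec (transCoord n u)) - B.1.mulVec (A.1.mulVec (transCoord n u))
    rw [Matrix.sub_mulVec, Matrix.mulVec_mulVec, Matrix.mulVec_mulVec]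

/-- The complexified Euclidean Lie algebra `𝔢ₙ = 𝔬(n, ℂ) ⋉ ℂⁿ`. -/
abbrev EuclAlg (n : ℕ) : Type :=
  LieAlgebra.SemiDirectSum (TransAlg n) (OrthAlg n) (rotationAction n)

/-- The inclusion `ℂⁿ → 𝔢ₙ` as the ideal of translations. -/
def transIncl (n : ℕ) : TransAlg n →ₗ[ℂ] EuclAlg n :=
  (LieAlgebra.SemiDirectSum.inl (rotationAction n) : TransAlg n →ₗ[ℂ] EuclAlg n)

/-- The inclusion `𝔬(n, ℂ) → 𝔢ₙ`. -/
def rotIncl (n : ℕ) : OrthAlg n →ₗ[ℂ] EuclAlg n :=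
  (LieAlgebra.SemiDirectSum.inr (rotationAction n) : OrthAlg n →ₗ[ℂ] EuclAlg n)

/-- The generator `lᵢⱼ` of `𝔬(n, ℂ)`: the skew matrix with `lᵢⱼ eᵢ = eⱼ`, `lᵢⱼ eⱼ = -eᵢ` for
`i ≠ j`, and `lᵢᵢ = 0`. -/
def lMat {n : ℕ} (i j : Fin n) : OrthAlg n :=
  ⟨Matrix.single j i 1 - Matrix.single i j 1, by
    rw [LieAlgebra.Orthogonal.mem_so, Matrix.transpose_sub, Matrix.transpose_single,
      Matrix.transpose_single, neg_sub]⟩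

/-! ### Second cohomology -/

section Cohomology

variable (R L M : Type*) [CommRing R] [LieRing L] [LieAlgebra R L]
  [AddCommGroup M] [Module R M] [LieRingModule L M] [LieModule R L M]

/-- The additive group structure of the space of 2-cocycles (that of a submodule). -/
instance : AddCommGroup (twoCocycle R L M) :=
  Submodule.addCommGroup (M := twoCochain R L M) (twoCocycle R L M)

/-- The 2-coboundaries, as a submodule of the 2-cocycles. -/
def twoCoboundary : Submodule R (twoCocycle R L M) :=
  (LinearMap.range (d₁₂ R L M)).comap (twoCocycle R L M).subtype

/-- The second Lie algebra cohomology `H²(L, M)`: 2-cocycles modulo 2-coboundaries. -/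
abbrev LieH2 : Type _ := twoCocycle R L M ⧸ twoCoboundary R L M

end Cohomology

/-! ### Deformations of Lie brackets -/

section Deformations

variable {R L : Type*} [CommRing R]

/-- A bilinear product is a Lie bracket: it is alternating and satisfies the Jacobi identity. -/
structure IsLieBracket [AddCommGroup L] [Module R L] (μ : L →ₗ[R] L →ₗ[R] L) : Prop where
  alternating : ∀ x, μ x x = 0
  jacobi : ∀ x y z, μ x (μ y z) + μ y (μ z x) + μ z (μ x y) = 0

variable [LieRing L] [LieAlgebra R L]

variable (R L) in
/-- The bracket of a Lie algebra as a bilinear map. -/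
def lieBracketMap : L →ₗ[R] L →ₗ[R] L := (LieModule.toEnd R L L : L →ₗ[R] Module.End R L)

/-- The sequence `φ` of alternating bilinear maps is a formal one-parameter deformation
`∑ₖ tᵏ φₖ` of the bracket of `L`: `φ₀` is the bracket, and the Jacobi identity holds in every
degree in `t`. The infinitesimal of this deformation is `φ₁`. -/
structure IsFormalDeformation (φ : ℕ → twoCochain R L L) : Prop where
  zeroth : ∀ x y, φ 0 x y = ⁅x, y⁆
  jacobi : ∀ (k : ℕ) (x y z : L), ∑ p ∈ Finset.HasAntidiagonal.antidiagonal k,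
    (φ p.1 x (φ p.2 y z) + φ p.1 y (φ p.2 z x) + φ p.1 z (φ p.2 x y)) = 0

/-- A 2-cocycle of `L` with values in the adjoint module is integrable if it is the infinitesimal of
a formal one-parameter deformation. -/
def IsIntegrable (c : twoCocycle R L L) : Prop :=
  ∃ φ : ℕ → twoCochain R L L, IsFormalDeformation φ ∧ φ 1 = c

end Deformations

/-! ### Invariant 2-cocycles on the ideal of translations, with values in `𝔢ₙ` -/

section Translations

variable {n : ℕ}

/-- The 2-cocycles of the abelian Lie algebra `ℂⁿ` with values in `𝔢ₙ`. -/
structure IsTransCocycle (f : TransAlg n →ₗ[ℂ] TransAlg n →ₗ[ℂ] EuclAlg n) : Prop where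
  alternating : ∀ u, f u u = 0
  cocycle : ∀ u v w, ⁅transIncl n u, f v w⁆ - ⁅transIncl n v, f u w⁆ + ⁅transIncl n w, f u v⁆ = 0

/-- The 2-coboundaries of the abelian Lie algebra `ℂⁿ` with values in `𝔢ₙ`. -/
def IsTransCoboundary (f : TransAlg n →ₗ[ℂ] TransAlg n →ₗ[ℂ] EuclAlg n) : Prop :=
  ∃ l : TransAlg n →ₗ[ℂ] EuclAlg n, ∀ u v, f u v = ⁅l u, transIncl n v⁆ + ⁅transIncl n u, l v⁆

/-- Invariance up to coboundaries under `𝔬(n, ℂ)`: for every `g`, the map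
`(u, v) ↦ [g, f(u, v)] - f([g, u], v) - f(u, [g, v])` is a 2-coboundary. -/
def IsRotInvariant (f : TransAlg n →ₗ[ℂ] TransAlg n →ₗ[ℂ] EuclAlg n) : Prop :=
  ∀ g : OrthAlg n, ∃ h : TransAlg n →ₗ[ℂ] TransAlg n →ₗ[ℂ] EuclAlg n, IsTransCoboundary h ∧
    ∀ u v, h u v = ⁅rotIncl n g, f u v⁆ - f (rotationAction n g u) v - f u (rotationAction n g v)

variable (n) in
/-- The bilinear map `f : ℂⁿ × ℂⁿ → 𝔢ₙ` with `f(eᵢ, eⱼ) = lᵢⱼ`, that is,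
`f(u, v) = ∑ᵢⱼ uᵢ vⱼ lᵢⱼ`. -/
def rotCocycle : TransAlg n →ₗ[ℂ] TransAlg n →ₗ[ℂ] EuclAlg n :=
  LinearMap.mk₂ ℂ
    (fun u v => ∑ i, ∑ j, (transCoord n u i * transCoord n v j) • rotIncl n (lMat i j))
    (fun u u' v => by
      simp only [map_add, Pi.add_apply, add_mul, add_smul, Finset.sum_add_distrib])
    (fun c u v => by
      simp only [map_smul, Pi.smul_apply, smul_eq_mul, Finset.smul_sum, smul_smul, mul_assoc])
    (fun u v v' => by
      simp only [map_add, Pi.add_apply, mul_add, add_smul, Finset.sum_add_distrib])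
    (fun c u v => by
      simp only [map_smul, Pi.smul_apply, smul_eq_mul, Finset.smul_sum, smul_smul,
        mul_left_comm c])

theorem rotCocycle_apply (u v : TransAlg n) : rotCocycle n u v =
    ∑ i, ∑ j, (transCoord n u i * transCoord n v j) • rotIncl n (lMat i j) := rfl

theorem rotCocycle_eVec (i j : Fin n) :
    rotCocycle n (eVec i) (eVec j) = rotIncl n (lMat i j) := by
  rw [rotCocycle_apply, Finset.sum_eq_single i, Finset.sum_eq_single j]
  · simp only [eVec, LinearEquiv.apply_symm_apply, Pi.single_eq_same, mul_one, one_smul]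
  · intro b _ hb
    simp only [eVec, LinearEquiv.apply_symm_apply]
    rw [Pi.single_eq_of_ne hb, mul_zero, zero_smul]
  · exact fun h => absurd (Finset.mem_univ j) h
  · intro b _ hb
    refine Finset.sum_eq_zero fun k _ => ?_
    simp only [eVec, LinearEquiv.apply_symm_apply]
    rw [Pi.single_eq_of_ne hb, zero_mul, zero_smul]
  · exact fun h => absurd (Finset.mem_univ i) h

theorem rotCocycle_self (u : TransAlg n) : rotCocycle n u u = 0 := by
  have hl (i j : Fin n) : (lMat j i : OrthAlg n) = -lMat i j := by
    apply Subtype.ext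
    simp [lMat]
  have h : rotCocycle n u u = -rotCocycle n u u := by
    conv_lhs => rw [rotCocycle_apply, Finset.sum_comm]
    rw [rotCocycle_apply]
    simp only [← Finset.sum_neg_distrib]
    refine Finset.sum_congr rfl fun i _ => Finset.sum_congr rfl fun j _ => ?_
    rw [hl, map_neg, smul_neg, mul_comm]
  have h2 : (2 : ℂ) • rotCocycle n u u = 0 := by
    rw [two_smul]
    nth_rewrite 1 [h]
    exact neg_add_cancel _
  exact (smul_eq_zero.mp h2).resolve_left two_ne_zero

variable (n) in
/-- The extension of `rotCocycle` to a 2-cochain of `𝔢ₙ` with values in the adjoint module that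
vanishes as soon as one argument lies in `𝔬(n, ℂ)`. -/
def euclCochain : twoCochain ℂ (EuclAlg n) (EuclAlg n) :=
  ⟨(rotCocycle n).compl₁₂ (LieAlgebra.SemiDirectSum.projl (rotationAction n))
      (LieAlgebra.SemiDirectSum.projl (rotationAction n)),
    fun x => rotCocycle_self x.left⟩

variable (n) in
/-- The deformed bracket `[x, y]_ε = [x, y] + ε f(x, y)` on `𝔢ₙ`: it has `[eᵢ, eⱼ]_ε = ε lᵢⱼ`, the
other brackets of basis elements being those of `𝔢ₙ`. -/
def deformedBracket (ε : ℂ) : EuclAlg n →ₗ[ℂ] EuclAlg n →ₗ[ℂ] EuclAlg n :=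
  lieBracketMap ℂ (EuclAlg n) + ε • (euclCochain n).val

end Translations

end

/-!
For alternating `f : ℂⁿ × ℂⁿ → 𝔢ₙ` the `𝔬(n, ℂ)`-component is a curvature tensor, for which the
cocycle condition is the Bianchi identity, and the `ℂⁿ`-component is a torsion. Torsions are
coboundaries: Koszul's formula (`exists_torsion_eq`) produces a Levi-Civita connection
`l : ℂⁿ → 𝔬(n, ℂ)`, which is unique and therefore equivariant if the torsion is invariant
(`map_rotationAction_of_torsion`). A rotation-invariant curvature tensor has constant curvature,
so it is a multiple of `wedge : (u, v) ↦ v uᵀ - u vᵀ` (`exists_eq_smul_wedge`); contracting the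
invariance condition and using Bianchi proves this uniformly in `n`. The Bianchi identity is
needed: for `n = 4` the Hodge star is another invariant endomorphism of `Λ²ℂⁿ`. Coboundaries have
no `𝔬(n, ℂ)`-component, so `wedge` is not one.

For `H²(𝔢ₙ, 𝔢ₙ)`, the general theorems on semisimple Lie algebras are replaced by the unitary
trick. The matrices `lᵢⱼ` act on cochains by operators skew-Hermitian for a positive definite
form, so the sum `Γ` of their squares is semidefinite, its kernel consists of the invariants, and
every cocycle is an invariant one plus one in the image of `Γ` (`exists_eq_add_sum_sq`). By
Cartan's formula Lie derivatives of cocycles are coboundaries. An invariant cocycle `φ` satisfies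
`φ([x, y], z) = [φ(x, y), z]` for `x, y` in `𝔬(n, ℂ)` (`cocycle_lie_eq`); as `𝔬(n, ℂ)` is perfect
for `n ≥ 3` and `𝔢ₙ` has no centre, `φ(w, ·) = ad (D w)` for a linear `D`, and subtracting the
coboundary of `D` gives a cocycle vanishing on `𝔬(n, ℂ)` (`exists_relative_cocycle`). Such a
cocycle is determined by its restriction to `ℂⁿ`, to which the first paragraph applies.

Hence every cocycle is `c F + dψ`, with `F = euclCochain n`. Since `F` is a cocycle which takes
values in `𝔬(n, ℂ)` and vanishes there, `[·,·] + t F` satisfies the Jacobi identity, and so does its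
transform by the formal automorphism `1 + t ψ`, whose infinitesimal is `F + dψ`
(`isFormalDeformation_gaugeTransform`). Finally, with `s² = ε`, bordering `A` by the column `s u` and
the row `-s uᵀ` identifies `[·,·]_ε` with the commutator of `𝔬(n + 1, ℂ)`
(`bordered_deformedBracket`).
-/

noncomputable section

/-! ### The Lie algebra `𝔢ₙ` in coordinates -/

section Basics

variable {n : ℕ}

theorem EuclAlg.lie_left (x y : EuclAlg n) : (⁅x, y⁆ : EuclAlg n).left =
    rotationAction n x.right y.left - rotationAction n y.right x.left := by
  rw [LieAlgebra.SemiDirectSum.lie_eq_mk, TransAlg.lie_eq_zero, zero_add]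

theorem EuclAlg.eq_transIncl_add_rotIncl (x : EuclAlg n) :
    x = transIncl n x.left + rotIncl n x.right :=
  LieAlgebra.SemiDirectSum.ext (add_zero _).symm (zero_add _).symm

theorem transCoord_rotationAction (A : OrthAlg n) (u : TransAlg n) :
    transCoord n (rotationAction n A u) = A.1.mulVec (transCoord n u) := rfl

theorem transCoord_eVec (i j : Fin n) : transCoord n (eVec i) j = if j = i then 1 else 0 := by
  simp [eVec, Pi.single_apply]

theorem TransAlg.eq_sum_eVec (u : TransAlg n) : u = ∑ i, transCoord n u i • eVec i := by
  apply (transCoord n).injective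
  ext j
  simp [map_sum, Finset.sum_apply, transCoord_eVec]

theorem OrthAlg.apply_swap (A : OrthAlg n) (i j : Fin n) : A.1 j i = -A.1 i j :=
  congrFun (congrFun ((LieAlgebra.Orthogonal.mem_so _ _ _).mp A.2) i) j

theorem OrthAlg.apply_self (A : OrthAlg n) (i : Fin n) : A.1 i i = 0 :=
  self_eq_neg.mp (A.apply_swap i i)

theorem OrthAlg.add_apply (A B : OrthAlg n) (i j : Fin n) :
    (A + B).1 i j = A.1 i j + B.1 i j := rfl

theorem OrthAlg.sub_apply (A B : OrthAlg n) (i j : Fin n) :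
    (A - B).1 i j = A.1 i j - B.1 i j := rfl

theorem OrthAlg.smul_apply (t : ℂ) (A : OrthAlg n) (i j : Fin n) :
    (t • A).1 i j = t * A.1 i j := rfl

theorem OrthAlg.sum_apply {ι : Type*} (s : Finset ι) (A : ι → OrthAlg n) (i j : Fin n) :
    (∑ k ∈ s, A k).1 i j = ∑ k ∈ s, (A k).1 i j := by
  simp [Matrix.sum_apply]

theorem lMat_apply (i j a b : Fin n) : (lMat i j : OrthAlg n).1 a b =
    (if a = j then 1 else 0) * (if b = i then 1 else 0)
      - (if a = i then 1 else 0) * (if b = j then 1 else 0) := by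
  simp only [lMat, Matrix.sub_apply, Matrix.single_apply, ← ite_and, mul_ite, mul_one, mul_zero]
  congr 1 <;> congr 1 <;> simp only [eq_comm, and_comm]

variable (n) in
/-- The identification `Λ²ℂⁿ ≅ 𝔬(n, ℂ)`, `u ∧ v ↦ v uᵀ - u vᵀ`, as a bilinear map. -/
def wedge : TransAlg n →ₗ[ℂ] TransAlg n →ₗ[ℂ] OrthAlg n :=
  (rotCocycle n).compr₂ (LieAlgebra.SemiDirectSum.projr (rotationAction n)).toLinearMap

theorem wedge_apply (u v : TransAlg n) (a b : Fin n) : (wedge n u v).1 a b =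
    transCoord n v a * transCoord n u b - transCoord n u a * transCoord n v b := by
  have h : wedge n u v = ∑ i, ∑ j, (transCoord n u i * transCoord n v j) • lMat i j := by
    change (LieAlgebra.SemiDirectSum.projr (rotationAction n)) (rotCocycle n u v) = _
    rw [rotCocycle_apply]
    simp only [map_sum, map_smul]
    rfl
  rw [h, OrthAlg.sum_apply]
  simp only [OrthAlg.sum_apply]
  have (i j : Fin n) : ((transCoord n u i * transCoord n v j) • (lMat i j : OrthAlg n)).1 a b =
    (transCoord n u i * transCoord n v j) * (lMat i j : OrthAlg n).1 a b := rfl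
  simp [this, lMat_apply, mul_sub, Finset.sum_sub_distrib]
  ring

theorem rotCocycle_eq_rotIncl_wedge (u v : TransAlg n) :
    rotCocycle n u v = rotIncl n (wedge n u v) := by
  refine LieAlgebra.SemiDirectSum.ext ?_ rfl
  change LieAlgebra.SemiDirectSum.projl (rotationAction n) (rotCocycle n u v) = 0
  rw [rotCocycle_apply]
  simp only [map_sum, map_smul]
  exact Finset.sum_eq_zero fun i _ => Finset.sum_eq_zero fun j _ => smul_zero _

theorem wedge_self (u : TransAlg n) : wedge n u u = 0 :=
  congrArg LieAlgebra.SemiDirectSum.right (rotCocycle_self u)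

theorem wedge_eVec (i j : Fin n) : wedge n (eVec i) (eVec j) = lMat i j :=
  congrArg LieAlgebra.SemiDirectSum.right (rotCocycle_eVec i j)

theorem transCoord_wedge_apply (u v w : TransAlg n) (a : Fin n) :
    transCoord n (rotationAction n (wedge n u v) w) a =
      (transCoord n u ⬝ᵥ transCoord n w) * transCoord n v a
        - (transCoord n v ⬝ᵥ transCoord n w) * transCoord n u a := by
  rw [transCoord_rotationAction]
  simp only [Matrix.mulVec, dotProduct, wedge_apply, sub_mul, Finset.sum_sub_distrib,
    Finset.sum_mul]
  congr 1 <;> exact Finset.sum_congr rfl fun _ _ => by ring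

/-- The Bianchi identity for the constant curvature tensor `wedge`. -/
theorem wedge_bianchi (u v w : TransAlg n) : rotationAction n (wedge n v w) u
    + rotationAction n (wedge n w u) v + rotationAction n (wedge n u v) w = 0 := by
  apply (transCoord n).injective
  ext a
  simp only [map_add, Pi.add_apply, transCoord_wedge_apply, map_zero, Pi.zero_apply,
    dotProduct_comm (transCoord n w), dotProduct_comm (transCoord n v) (transCoord n u)]
  ring

theorem OrthAlg.lie_apply (A B : OrthAlg n) (a b : Fin n) :
    (⁅A, B⁆ : OrthAlg n).1 a b = ∑ c, A.1 a c * B.1 c b - ∑ c, B.1 a c * A.1 c b := rfl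

theorem lie_wedge (A : OrthAlg n) (u v : TransAlg n) : ⁅A, wedge n u v⁆ =
    wedge n (rotationAction n A u) v + wedge n u (rotationAction n A v) := by
  ext a b
  change _ = (wedge n (rotationAction n A u) v).1 a b + (wedge n u (rotationAction n A v)).1 a b
  rw [OrthAlg.lie_apply]
  simp only [wedge_apply, transCoord_rotationAction, Matrix.mulVec, dotProduct, Finset.mul_sum,
    Finset.sum_mul, ← Finset.sum_sub_distrib, ← Finset.sum_add_distrib]
  refine Finset.sum_congr rfl fun c _ => ?_
  rw [A.apply_swap b c]
  ring

/-- The factor `1 / 2` is there because `lᵢⱼ = -lⱼᵢ` are both summed over. -/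
theorem OrthAlg.eq_sum_lMat (A : OrthAlg n) :
    A = ∑ i, ∑ j, ((1 / 2 : ℂ) * A.1 j i) • lMat i j := by
  ext a b
  rw [OrthAlg.sum_apply]
  simp only [OrthAlg.sum_apply]
  simp [lMat_apply, mul_sub, Finset.sum_sub_distrib, A.apply_swap a b]
  ring

theorem rotationAction_lMat_eVec (i j k : Fin n) : rotationAction n (lMat i j) (eVec k) =
    (if k = i then 1 else 0 : ℂ) • eVec j - (if k = j then 1 else 0 : ℂ) • eVec i := by
  apply (transCoord n).injective
  ext a
  rw [← wedge_eVec, transCoord_wedge_apply]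
  simp [transCoord_eVec, dotProduct]
  split_ifs <;> simp_all [transCoord_eVec]

theorem OrthAlg.eq_zero_of_rotationAction {A : OrthAlg n}
    (h : ∀ u, rotationAction n A u = 0) : A = 0 := by
  ext a b
  have := congrFun (congrArg (transCoord n) (h (eVec b))) a
  rw [transCoord_rotationAction] at this
  simpa [eVec] using this

/-- The Lie algebra `𝔢ₙ` has trivial centre for `n ≥ 2`. -/
theorem EuclAlg.eq_zero_of_lie_eq_zero (hn : 2 ≤ n) {d : EuclAlg n}
    (h : ∀ z : EuclAlg n, ⁅d, z⁆ = 0) : d = 0 := by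
  have hr : d.right = 0 := OrthAlg.eq_zero_of_rotationAction fun u => by
    have := congrArg LieAlgebra.SemiDirectSum.left (h (transIncl n u))
    rw [EuclAlg.lie_left] at this
    change _ - rotationAction n 0 _ = 0 at this
    rwa [map_zero, LieDerivation.coe_zero, Pi.zero_apply, sub_zero] at this
  refine LieAlgebra.SemiDirectSum.ext ?_ hr
  apply (transCoord n).injective
  ext i
  have : Nontrivial (Fin n) := Fin.nontrivial_iff_two_le.mpr hn
  obtain ⟨j, hj⟩ := exists_ne i
  have := congrArg LieAlgebra.SemiDirectSum.left (h (rotIncl n (lMat i j)))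
  rw [EuclAlg.lie_left, hr] at this
  have := congrFun (congrArg (transCoord n) this) j
  rw [map_zero, LieDerivation.coe_zero, Pi.zero_apply, zero_sub, map_neg] at this
  change -(transCoord n (rotationAction n (lMat i j) d.left)) j = 0 at this
  rw [← wedge_eVec, transCoord_wedge_apply] at this
  simpa [transCoord_eVec, dotProduct, hj] using this

/-- For `n ≥ 3` each `lᵢⱼ` is a commutator, `lᵢⱼ = [lₖⱼ, lᵢₖ]` with `k ≠ i, j`. -/
theorem lMat_eq_lie (hn : 3 ≤ n) (i j : Fin n) : ∃ A B : OrthAlg n, lMat i j = ⁅A, B⁆ := by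
  obtain ⟨k, hk⟩ : ∃ k, k ∉ ({i, j} : Finset (Fin n)) := by
    by_contra! h
    have h1 : (Finset.univ : Finset (Fin n)).card ≤ ({i, j} : Finset (Fin n)).card :=
      Finset.card_le_card fun k _ => h k
    have h2 := Finset.card_le_two (a := i) (b := j)
    rw [Finset.card_univ, Fintype.card_fin] at h1
    omega
  simp only [Finset.mem_insert, Finset.mem_singleton, not_or] at hk
  obtain ⟨hi, hj⟩ := hk
  by_cases hij : i = j
  · refine ⟨0, 0, ?_⟩
    rw [lie_self, hij, ← wedge_eVec, wedge_self]
  refine ⟨lMat k j, lMat i k, ?_⟩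
  rw [← wedge_eVec i k, lie_wedge, rotationAction_lMat_eVec, rotationAction_lMat_eVec,
    ← wedge_eVec]
  simp [Ne.symm hi, hij, hj]

end Basics

/-! ### Invariant cocycles on the ideal of translations -/

section Translations

variable {n : ℕ}

variable (n) in
/-- The standard basis of `ℂⁿ`, with members `eVec i`. -/
def eBasis : Module.Basis (Fin n) ℂ (TransAlg n) := .ofEquivFun (transCoord n)

theorem eBasis_apply (i : Fin n) : eBasis n i = eVec i := by
  simp [eBasis, eVec, Module.Basis.coe_ofEquivFun]

/-- Existence of the Levi-Civita connection of a torsion `p`, by Koszul's formula: an alternating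
map `p` with values in `ℂⁿ` is the antisymmetrisation of a linear map `ℂⁿ → 𝔬(n, ℂ)`. -/
theorem exists_torsion_eq (p : TransAlg n →ₗ[ℂ] TransAlg n →ₗ[ℂ] TransAlg n)
    (hp : ∀ u, p u u = 0) : ∃ l : TransAlg n →ₗ[ℂ] OrthAlg n,
      ∀ u v, p u v = rotationAction n (l u) v - rotationAction n (l v) u := by
  have hs (u v : TransAlg n) (a : Fin n) :
      transCoord n (p v u) a = -transCoord n (p u v) a := by
    rw [← LinearMap.IsAlt.neg (B := p) hp u v, map_neg, Pi.neg_apply]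
  let M (u : TransAlg n) : Matrix (Fin n) (Fin n) ℂ := Matrix.of fun a b =>
    (1 / 2 : ℂ) * (transCoord n (p u (eVec b)) a + transCoord n (p (eVec a) u) b
      + ∑ i, transCoord n (p (eVec a) (eVec b)) i * transCoord n u i)
  have hM (u : TransAlg n) : M u ∈ LieAlgebra.Orthogonal.so (Fin n) ℂ := by
    rw [LieAlgebra.Orthogonal.mem_so]
    ext a b
    simp only [M, Matrix.transpose_apply, Matrix.neg_apply, Matrix.of_apply, hs (eVec a) (eVec b),
      hs u (eVec a), hs u (eVec b), neg_mul, Finset.sum_neg_distrib]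
    ring
  let l : TransAlg n →ₗ[ℂ] OrthAlg n :=
    { toFun := fun u => ⟨M u, hM u⟩
      map_add' := fun u v => by
        ext a b
        rw [OrthAlg.add_apply]
        simp only [M, Matrix.of_apply, map_add,
          LinearMap.add_apply, Pi.add_apply, mul_add, Finset.sum_add_distrib]
        ring
      map_smul' := fun t u => by
        ext a b
        rw [OrthAlg.smul_apply]
        simp only [M, Matrix.of_apply, map_smul,
          LinearMap.smul_apply, Pi.smul_apply, smul_eq_mul, mul_add, Finset.mul_sum,
          RingHom.id_apply]
        congr 1
        · ring
        · exact Finset.sum_congr rfl fun _ _ => by ring }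
  let A : TransAlg n →ₗ[ℂ] TransAlg n →ₗ[ℂ] TransAlg n := LinearMap.mk₂ ℂ
    (fun u v => rotationAction n (l u) v) (fun u u' v => by rw [map_add, map_add]; rfl)
    (fun t u v => by rw [map_smul, map_smul]; rfl) (fun u v v' => map_add _ _ _)
    (fun t u v => map_smul _ _ _)
  have hA (i j a : Fin n) : transCoord n (A (eVec i) (eVec j)) a = M (eVec i) a j := by
    change (M (eVec i)).mulVec (transCoord n (eVec j)) a = _
    simp [eVec]
  have : p = A - A.flip := by
    refine LinearMap.ext_basis (eBasis n) (eBasis n) fun i j => ?_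
    simp only [eBasis_apply, LinearMap.sub_apply, LinearMap.flip_apply]
    apply (transCoord n).injective
    ext a
    rw [map_sub, Pi.sub_apply, hA, hA]
    simp only [M, Matrix.of_apply, hs (eVec i) (eVec j), transCoord_eVec, mul_ite, mul_one,
      mul_zero, Finset.sum_ite_eq', Finset.mem_univ, if_true]
    ring
  exact ⟨l, fun u v => by rw [this]; rfl⟩

/-- Uniqueness of the Levi-Civita connection: a trilinear form symmetric in the first two and
skew in the last two arguments vanishes. -/
theorem eq_zero_of_torsion_eq_zero (l : TransAlg n →ₗ[ℂ] OrthAlg n)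
    (h : ∀ u v, rotationAction n (l u) v = rotationAction n (l v) u) : l = 0 := by
  have hc (i j a : Fin n) : (l (eVec i)).1 a j = (l (eVec j)).1 a i := by
    have := congrFun (congrArg (transCoord n) (h (eVec i) (eVec j))) a
    simpa [transCoord_rotationAction, eVec] using this
  refine (eBasis n).ext fun i => ?_
  rw [eBasis_apply]
  ext a b
  change (l (eVec i)).1 a b = 0
  have h1 := hc i b a
  have h2 := (l (eVec b)).apply_swap a i
  have h3 := hc b a i
  have h4 := (l (eVec a)).apply_swap b i
  have h5 := hc a i b
  have h6 := (l (eVec i)).apply_swap a b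
  linear_combination (1 / 2 : ℂ) * (h1 + h2 - h3 - h4 + h5 + h6)

/-- By uniqueness, the Levi-Civita connection of a rotation-invariant torsion is equivariant. -/
theorem map_rotationAction_of_torsion (l : TransAlg n →ₗ[ℂ] OrthAlg n)
    (h : ∀ g u v, rotationAction n g (rotationAction n (l u) v - rotationAction n (l v) u) =
      (rotationAction n (l (rotationAction n g u)) v
        - rotationAction n (l v) (rotationAction n g u))
      + (rotationAction n (l u) (rotationAction n g v)
        - rotationAction n (l (rotationAction n g v)) u))
    (g : OrthAlg n) (u : TransAlg n) : l (rotationAction n g u) = ⁅g, l u⁆ := by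
  let δ : TransAlg n →ₗ[ℂ] OrthAlg n :=
    (LieAlgebra.ad ℂ (OrthAlg n) g) ∘ₗ l - l ∘ₗ (rotationAction n g).toLinearMap
  have hδ (u : TransAlg n) : δ u = ⁅g, l u⁆ - l (rotationAction n g u) := rfl
  refine (sub_eq_zero.mp ?_).symm
  rw [← hδ]
  refine LinearMap.congr_fun (eq_zero_of_torsion_eq_zero δ fun u v => ?_) u
  have h1 := sub_eq_zero.mpr (h g u v)
  rw [map_sub] at h1
  rw [hδ, hδ, map_sub, map_sub, LieHom.map_lie, LieHom.map_lie, LieDerivation.sub_apply,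
    LieDerivation.sub_apply, LieDerivation.lie_apply, LieDerivation.lie_apply, ← sub_eq_zero, ← h1]
  abel

/-- A rotation-invariant algebraic curvature tensor has constant sectional curvature. With
`R i j a b` the coordinates of `q`, contracting the invariance under `l_{pr}` over `p` and using
the Bianchi identity gives `(1 - n) R i j a r = δ_{jr} P i a - δ_{ir} P j a` for the Ricci tensor
`P`; skewness in `a, r` and a further contraction force `P` to be scalar. -/
theorem exists_eq_smul_wedge (hn : 2 ≤ n) (q : TransAlg n →ₗ[ℂ] TransAlg n →ₗ[ℂ] OrthAlg n)
    (hself : ∀ u, q u u = 0)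
    (bianchi : ∀ u v w, rotationAction n (q v w) u + rotationAction n (q w u) v
      + rotationAction n (q u v) w = 0)
    (hq : ∀ g u v, ⁅g, q u v⁆ = q (rotationAction n g u) v + q u (rotationAction n g v)) :
    ∃ c : ℂ, q = c • wedge n := by
  have hb (i j k a : Fin n) : (q (eVec j) (eVec k)).1 a i + (q (eVec k) (eVec i)).1 a j
      + (q (eVec i) (eVec j)).1 a k = 0 := by
    have := congrFun (congrArg (transCoord n) (bianchi (eVec i) (eVec j) (eVec k))) a
    simpa [transCoord_rotationAction, eVec] using this
  set R : Fin n → Fin n → Fin n → Fin n → ℂ := fun i j a b => (q (eVec i) (eVec j)).1 a b with hR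
  set P : Fin n → Fin n → ℂ := fun j a => ∑ p, R p j a p with hP
  have hskew (i j a b : Fin n) : R j i a b = -R i j a b := by
    simp only [hR]
    rw [← LinearMap.IsAlt.neg (B := q) hself (eVec i)]
    rfl
  have hskew' (i j a b : Fin n) : R i j b a = -R i j a b := OrthAlg.apply_swap _ _ _
  have hcontr (i j a r : Fin n) : (1 - n : ℂ) * R i j a r =
      (if j = r then 1 else 0) * P i a - (if i = r then 1 else 0) * P j a := by
    have hinv (p : Fin n) := congrFun (congrFun (congrArg Subtype.val
      (hq (lMat p r) (eVec i) (eVec j))) a) p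
    simp only [OrthAlg.lie_apply, rotationAction_lMat_eVec, lMat_apply, map_sub, map_smul,
      LinearMap.sub_apply, LinearMap.smul_apply, OrthAlg.add_apply, OrthAlg.sub_apply,
      OrthAlg.smul_apply] at hinv
    have hsum := Finset.sum_congr (rfl : (Finset.univ : Finset (Fin n)) = _) fun p _ => hinv p
    have hPi : ∑ p, (q (eVec i) (eVec p)).1 a p = -P i a := by
      rw [hP, ← Finset.sum_neg_distrib]
      exact Finset.sum_congr rfl fun p _ => hskew p i a p
    have hPj : ∑ p, (q (eVec p) (eVec j)).1 a p = P j a := rfl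
    simp only [mul_sub, sub_mul, Finset.sum_sub_distrib, Finset.sum_add_distrib, ite_mul, mul_ite,
      one_mul, mul_one, zero_mul, mul_zero, Finset.sum_ite_eq, Finset.sum_ite_eq', Finset.mem_univ,
      if_true, OrthAlg.apply_self, Finset.sum_const, Finset.card_univ, Fintype.card_fin,
      nsmul_eq_mul, Finset.sum_ite_irrel, ite_self, hPi, hPj] at hsum
    have h1 := hb i j r a
    have h2 := hskew' i j r a
    have h3 := hskew i r a j
    have h4 := hskew j r a i
    simp only [hR] at h2 h3 h4 ⊢
    simp only [ite_mul, one_mul, zero_mul]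
    split_ifs at hsum ⊢ <;> linear_combination hsum - h1 + h2 + h3 + h4
  have hP' (j a : Fin n) : (n : ℂ) * P j a = (if j = a then 1 else 0) * ∑ i, P i i := by
    -- Contract `R i j a r + R i j r a = 0`, in the form given by `hcontr`, over `i = r`.
    have h0 := Finset.sum_eq_zero (s := Finset.univ) fun (i : Fin n) _ => show
      (1 - n : ℂ) * R i j a i + (1 - n : ℂ) * R i j i a = 0 by rw [hskew' i j a i]; ring
    simp only [hcontr, Finset.sum_add_distrib, Finset.sum_sub_distrib, ite_mul, one_mul, zero_mul,
      Finset.sum_ite_eq, Finset.sum_ite_eq', Finset.mem_univ, if_true, Finset.sum_const,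
      Finset.card_univ, Fintype.card_fin, nsmul_eq_mul, Finset.sum_ite_irrel,
      mul_zero] at h0
    rw [ite_mul, one_mul, zero_mul]
    linear_combination -h0
  have hn0 : (n : ℂ) ≠ 0 := Nat.cast_ne_zero.mpr (by omega)
  have hn1 : (1 - n : ℂ) ≠ 0 := fun h => by
    have : (n : ℂ) = (1 : ℕ) := by rw [Nat.cast_one]; exact (sub_eq_zero.mp h).symm
    have := Nat.cast_injective this
    omega
  refine ⟨-(∑ i, P i i) / ((1 - n) * n), LinearMap.ext_basis (eBasis n) (eBasis n) fun i j => ?_⟩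
  rw [eBasis_apply, eBasis_apply, LinearMap.smul_apply, LinearMap.smul_apply, wedge_eVec]
  ext a r
  change R i j a r = _
  rw [OrthAlg.smul_apply, lMat_apply]
  rw [← mul_right_inj' (mul_ne_zero hn1 hn0), ← mul_assoc,
    mul_div_cancel₀ _ (mul_ne_zero hn1 hn0)]
  simp only [eq_comm (a := a), eq_comm (a := r)]
  linear_combination (n : ℂ) * hcontr i j a r + (if j = r then 1 else 0) * hP' i a
    - (if i = r then 1 else 0) * hP' j a

/-- The `ℂⁿ`-component of the cocycle condition involves only the `𝔬(n, ℂ)`-component of `f`, and is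
the Bianchi identity for it. -/
theorem IsTransCocycle.bianchi {f : TransAlg n →ₗ[ℂ] TransAlg n →ₗ[ℂ] EuclAlg n}
    (hf : IsTransCocycle f) (u v w : TransAlg n) : rotationAction n (f v w).right u
      + rotationAction n (f w u).right v + rotationAction n (f u v).right w = 0 := by
  have h1 := congrArg (LieAlgebra.SemiDirectSum.projl (rotationAction n)) (hf.cocycle u v w)
  rw [← LinearMap.IsAlt.neg (B := f) hf.alternating w u] at h1
  simp only [map_add, map_sub, lie_neg, map_neg] at h1
  simp only [LieAlgebra.SemiDirectSum.projl_mk, EuclAlg.lie_left] at h1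
  change (rotationAction n 0 _ - rotationAction n _ u) - -(rotationAction n 0 _ -
    rotationAction n _ v) + (rotationAction n 0 _ - rotationAction n _ w) = 0 at h1
  simp only [map_zero, LieDerivation.coe_zero, Pi.zero_apply] at h1
  rw [← neg_eq_zero, ← h1]
  abel

theorem lie_rotIncl_transIncl (A : OrthAlg n) (u : TransAlg n) :
    ⁅rotIncl n A, transIncl n u⁆ = transIncl n (rotationAction n A u) := by
  refine LieAlgebra.SemiDirectSum.ext ?_ (lie_zero A)
  rw [EuclAlg.lie_left]
  change _ - rotationAction n 0 0 = _
  rw [map_zero, sub_zero]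
  rfl

theorem lie_transIncl_transIncl (u v : TransAlg n) : ⁅transIncl n u, transIncl n v⁆ = 0 := by
  refine LieAlgebra.SemiDirectSum.ext ?_ (lie_zero _)
  rw [EuclAlg.lie_left]
  change rotationAction n 0 v - rotationAction n 0 u = 0
  rw [map_zero, LieDerivation.coe_zero, Pi.zero_apply, Pi.zero_apply, sub_zero]

theorem lie_rotIncl_rotIncl (A B : OrthAlg n) : ⁅rotIncl n A, rotIncl n B⁆ = rotIncl n ⁅A, B⁆ :=
  ((LieAlgebra.SemiDirectSum.inr (rotationAction n)).map_lie A B).symm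

theorem IsTransCoboundary.right_eq_zero {f : TransAlg n →ₗ[ℂ] TransAlg n →ₗ[ℂ] EuclAlg n}
    (hf : IsTransCoboundary f) (u v : TransAlg n) : (f u v).right = 0 := by
  obtain ⟨l, hl⟩ := hf
  rw [hl]
  change ⁅(l u).right, (0 : OrthAlg n)⁆ + ⁅(0 : OrthAlg n), (l v).right⁆ = 0
  rw [lie_zero, zero_lie, add_zero]

/-- If the `𝔬(n, ℂ)`-component of a cocycle `f` is invariant, it is a multiple of `wedge`; the
`ℂⁿ`-component is always the coboundary of a connection `l`. -/
theorem IsTransCocycle.exists_decomposition (hn : 2 ≤ n)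
    {f : TransAlg n →ₗ[ℂ] TransAlg n →ₗ[ℂ] EuclAlg n} (hf : IsTransCocycle f)
    (hinv : ∀ g u v, ⁅g, (f u v).right⁆ =
      (f (rotationAction n g u) v).right + (f u (rotationAction n g v)).right) :
    ∃ (c : ℂ) (l : TransAlg n →ₗ[ℂ] OrthAlg n), ∀ u v, f u v = c • rotCocycle n u v
      + transIncl n (rotationAction n (l u) v - rotationAction n (l v) u) := by
  obtain ⟨c, hc⟩ := exists_eq_smul_wedge hn
    (f.compr₂ (LieAlgebra.SemiDirectSum.projr (rotationAction n)).toLinearMap)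
    (fun u => congrArg LieAlgebra.SemiDirectSum.right (hf.alternating u)) hf.bianchi hinv
  obtain ⟨l, hl⟩ := exists_torsion_eq (f.compr₂ (LieAlgebra.SemiDirectSum.projl (rotationAction n)))
    (fun u => congrArg LieAlgebra.SemiDirectSum.left (hf.alternating u))
  refine ⟨c, l, fun u v => ?_⟩
  have hr : (f u v).right = c • wedge n u v := LinearMap.congr_fun₂ hc u v
  rw [← hl, rotCocycle_eq_rotIncl_wedge, ← map_smul, ← hr, add_comm]
  exact EuclAlg.eq_transIncl_add_rotIncl _

theorem isTransCocycle_rotCocycle : IsTransCocycle (rotCocycle n) where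
  alternating := rotCocycle_self
  cocycle u v w := by
    have h := wedge_bianchi u v w
    rw [← LinearMap.IsAlt.neg (B := wedge n) wedge_self u w, map_neg, LieDerivation.coe_neg,
      Pi.neg_apply] at h
    simp only [rotCocycle_eq_rotIncl_wedge, ← lie_skew (transIncl n _), lie_rotIncl_transIncl]
    rw [← map_zero (transIncl n), ← neg_zero, ← h, map_neg]
    simp only [map_add, map_neg]
    abel

theorem isRotInvariant_rotCocycle : IsRotInvariant (rotCocycle n) := fun g => by
  refine ⟨0, ⟨0, fun u v => by simp only [LinearMap.zero_apply, zero_lie, lie_zero, add_zero]⟩,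
    fun u v => ?_⟩
  simp only [rotCocycle_eq_rotIncl_wedge, lie_rotIncl_rotIncl, lie_wedge, map_add,
    LinearMap.zero_apply]
  abel

theorem not_isTransCoboundary_rotCocycle (hn : 2 ≤ n) : ¬ IsTransCoboundary (rotCocycle n) := by
  intro h
  have h1 := h.right_eq_zero (eVec ⟨0, by omega⟩) (eVec ⟨1, by omega⟩)
  rw [rotCocycle_eVec] at h1
  have h2 : (lMat ⟨0, by omega⟩ ⟨1, by omega⟩ : OrthAlg n).1 ⟨1, by omega⟩ ⟨0, by omega⟩ = 0 :=
    congrFun (congrFun (congrArg Subtype.val h1) _) _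
  simp [lMat_apply] at h2

theorem IsTransCocycle.exists_isTransCoboundary_sub (hn : 2 ≤ n)
    {f : TransAlg n →ₗ[ℂ] TransAlg n →ₗ[ℂ] EuclAlg n} (hf : IsTransCocycle f)
    (hinv : IsRotInvariant f) : ∃ c : ℂ, IsTransCoboundary (f - c • rotCocycle n) := by
  obtain ⟨c, l, h⟩ := hf.exists_decomposition hn fun g u v => by
    obtain ⟨k, hk, hk'⟩ := hinv g
    have := congrArg LieAlgebra.SemiDirectSum.right (hk' u v)
    rw [hk.right_eq_zero] at this
    change 0 = ⁅g, (f u v).right⁆ - (f (rotationAction n g u) v).right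
      - (f u (rotationAction n g v)).right at this
    rw [sub_sub] at this
    exact sub_eq_zero.mp this.symm
  refine ⟨c, rotIncl n ∘ₗ l, fun u v => ?_⟩
  simp only [LinearMap.sub_apply, LinearMap.smul_apply, h, LinearMap.comp_apply,
    ← lie_skew (transIncl n u), lie_rotIncl_transIncl, map_sub]
  abel

end Translations

/-! ### The unitary trick -/

section Unitary

open Matrix

/-- A finite family `D i` of operators which are skew-Hermitian with respect to a positive definite
Hermitian form, given as the pullback of the standard one by an injection `T`: every vector is the
sum of one killed by all `D i` and one in the image of `∑ i, D i ∘ D i`. Indeed that sum is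
negative semidefinite, and its kernel is the common kernel of the `D i`. -/
theorem exists_eq_add_sum_sq {V ι κ : Type*} [AddCommGroup V] [Module ℂ V] [FiniteDimensional ℂ V]
    [Fintype ι] [Fintype κ] (D : ι → V →ₗ[ℂ] V) (T : V →ₗ[ℂ] (κ → ℂ))
    (hT : Function.Injective T) (K : ι → Matrix κ κ ℂ) (hK : ∀ i, (K i)ᴴ = -K i)
    (hTD : ∀ i v, T (D i v) = K i *ᵥ T v) (v : V) :
    ∃ v₀ w, v = v₀ + ∑ i, D i (D i w) ∧ ∀ i, D i v₀ = 0 := by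
  have hskew (i : ι) (x y : V) : star (T (D i x)) ⬝ᵥ T y = -(star (T x) ⬝ᵥ T (D i y)) := by
    rw [hTD, hTD, star_mulVec, hK, ← dotProduct_mulVec, neg_mulVec, dotProduct_neg]
  set Γ : V →ₗ[ℂ] V := ∑ i, D i ∘ₗ D i with hΓ
  have hΓa (x : V) : Γ x = ∑ i, D i (D i x) := by simp [hΓ, LinearMap.sum_apply]
  have hker (x : V) (hx : Γ x = 0) (i : ι) : D i x = 0 := by
    have h0 : ∑ i, star (T (D i x)) ⬝ᵥ T (D i x) = 0 := by
      simp only [hskew, Finset.sum_neg_distrib, ← dotProduct_sum, ← map_sum, ← hΓa, hx, map_zero,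
        dotProduct_zero, neg_zero]
    open ComplexOrder in
    have := (Finset.sum_eq_zero_iff_of_nonneg fun i _ => dotProduct_star_self_nonneg _).mp h0 i
      (Finset.mem_univ i)
    open ComplexOrder in
    exact hT ((dotProduct_star_self_eq_zero.mp this).trans (map_zero T).symm)
  have hdisj : Disjoint (LinearMap.ker Γ) (LinearMap.range Γ) := by
    rw [Submodule.disjoint_def]
    rintro x hx ⟨w, rfl⟩
    have h0 : star (T (Γ w)) ⬝ᵥ T (Γ w) = 0 := by
      nth_rewrite 1 [hΓa w]
      rw [map_sum, star_sum, sum_dotProduct]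
      refine Finset.sum_eq_zero fun i _ => ?_
      rw [hskew, hker _ hx i, map_zero, dotProduct_zero, neg_zero]
    open ComplexOrder in
    exact hT ((dotProduct_star_self_eq_zero.mp h0).trans (map_zero T).symm)
  have htop := ((Submodule.isCompl_iff_disjoint _ _
    (by rw [add_comm, LinearMap.finrank_range_add_finrank_ker])).mpr hdisj).sup_eq_top
  obtain ⟨v₀, h₀, _, ⟨w, rfl⟩, h⟩ := Submodule.mem_sup.mp (htop ▸ Submodule.mem_top : v ∈ _)
  exact ⟨v₀, w, by rw [← h, hΓa], hker v₀ h₀⟩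

end Unitary

/-! ### Lie derivatives of cocycles -/

section LieDerivative

variable {R L M : Type*} [CommRing R] [LieRing L] [LieAlgebra R L] [AddCommGroup M] [Module R M]
  [LieRingModule L M] [LieModule R L M]

theorem d₁₂_mem_twoCocycle (f : oneCochain R L M) : d₁₂ R L M f ∈ twoCocycle R L M :=
  LinearMap.congr_fun (d₂₃_comp_d₁₂ R L M) f

variable (R L M) in
/-- The action of `L` on 2-cocycles by the Lie derivative. By Cartan's formula the action of `x` is
`φ ↦ d (ι_x φ)` on cocycles, which is taken as the definition. -/
def lieDerivative : L →ₗ[R] twoCocycle R L M →ₗ[R] twoCocycle R L M := LinearMap.mk₂ R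
  (fun x φ => ⟨d₁₂ R L M (φ.1 x), d₁₂_mem_twoCocycle _⟩)
  (fun x y φ => Subtype.ext <|
    (congrArg (d₁₂ R L M) (map_add φ.1 x y)).trans (map_add (d₁₂ R L M) _ _))
  (fun t x φ => Subtype.ext <|
    (congrArg (d₁₂ R L M) (map_smul φ.1 t x)).trans (map_smul (d₁₂ R L M) _ _))
  (fun x φ χ => Subtype.ext (map_add (d₁₂ R L M) (φ.1 x) (χ.1 x)))
  (fun t x φ => Subtype.ext (map_smul (d₁₂ R L M) t (φ.1 x)))

theorem cocycle_identity (φ : twoCocycle R L M) (x y z : L) :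
    ⁅x, φ.1 y z⁆ - ⁅y, φ.1 x z⁆ + ⁅z, φ.1 x y⁆ - φ.1 ⁅x, y⁆ z + φ.1 ⁅x, z⁆ y
      - φ.1 ⁅y, z⁆ x = 0 := by
  have h := (mem_twoCocycle_iff R L M φ.1).mp φ.2
  rw [← d₂₃_apply, h]
  rfl

theorem lieDerivative_apply (x : L) (φ : twoCocycle R L M) (y z : L) :
    (lieDerivative R L M x φ).1 y z = ⁅x, φ.1 y z⁆ - φ.1 ⁅x, y⁆ z - φ.1 y ⁅x, z⁆ := by
  change ⁅y, φ.1 x z⁆ - ⁅z, φ.1 x y⁆ - φ.1 x ⁅y, z⁆ = _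
  rw [← sub_eq_zero, ← neg_eq_zero, ← cocycle_identity φ x y z, ← twoCochain_skew φ.1 ⁅x, z⁆ y,
    ← twoCochain_skew φ.1 ⁅y, z⁆ x]
  abel

theorem mem_twoCoboundary_iff {φ : twoCocycle R L M} :
    φ ∈ twoCoboundary R L M ↔ ∃ ψ, d₁₂ R L M ψ = φ.1 := Iff.rfl

theorem lieDerivative_mem_twoCoboundary (x : L) (φ : twoCocycle R L M) :
    lieDerivative R L M x φ ∈ twoCoboundary R L M := ⟨φ.1 x, rfl⟩

/-- The cocycle identity with values in the adjoint module, as a cyclic sum. -/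
theorem cocycle_cyclic {F : twoCochain R L L} (hF : F ∈ twoCocycle R L L) (x y z : L) :
    ⁅x, F y z⁆ + F x ⁅y, z⁆ + (⁅y, F z x⁆ + F y ⁅z, x⁆) + (⁅z, F x y⁆ + F z ⁅x, y⁆) = 0 := by
  rw [← cocycle_identity ⟨F, hF⟩ x y z]
  change _ = ⁅x, F y z⁆ - ⁅y, F x z⁆ + ⁅z, F x y⁆ - F ⁅x, y⁆ z + F ⁅x, z⁆ y - F ⁅y, z⁆ x
  rw [← twoCochain_skew F z x, ← twoCochain_skew F z ⁅x, y⁆, ← twoCochain_skew F y ⁅x, z⁆,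
    ← twoCochain_skew F x ⁅y, z⁆, ← lie_skew z x, map_neg, lie_neg]
  abel

/-- For `x, y` preserving the cocycle `φ`, compare `d (ι_y φ) = 0` with the Lie derivative of `φ`
along `x`. -/
theorem cocycle_lie_eq (φ : twoCocycle R L L) {x y : L} (hx : lieDerivative R L L x φ = 0)
    (hy : lieDerivative R L L y φ = 0) (z : L) : φ.1 ⁅x, y⁆ z = ⁅φ.1 x y, z⁆ := by
  have h1 : (lieDerivative R L L x φ).1 y z = 0 := by rw [hx]; rfl
  have h2 : (lieDerivative R L L y φ).1 x z = 0 := by rw [hy]; rfl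
  rw [lieDerivative_apply] at h1
  change ⁅x, φ.1 y z⁆ - ⁅z, φ.1 y x⁆ - φ.1 y ⁅x, z⁆ = 0 at h2
  rw [← twoCochain_skew φ.1 x y, lie_neg, ← lie_skew z, neg_neg] at h2
  rw [← sub_eq_zero, ← sub_zero 0]
  nth_rewrite 1 [← h2]
  rw [← h1]
  abel

theorem span_mkQ_twoCocycle {F : twoCocycle R L M} (h : ∀ φ : twoCocycle R L M,
    ∃ (c : R) (ψ : oneCochain R L M), φ.1 = c • F.1 + d₁₂ R L M ψ) :
    Submodule.span R {(twoCoboundary R L M).mkQ F} = ⊤ := by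
  rw [eq_top_iff]
  intro x _
  obtain ⟨φ, rfl⟩ := Submodule.mkQ_surjective _ x
  obtain ⟨c, ψ, h⟩ := h φ
  rw [Submodule.mem_span_singleton]
  refine ⟨c, ?_⟩
  rw [← map_smul, ← sub_eq_zero, ← map_sub, Submodule.mkQ_apply, Submodule.Quotient.mk_eq_zero]
  refine mem_twoCoboundary_iff.mpr ⟨-ψ, ?_⟩
  change d₁₂ R L M (-ψ) = c • F.1 - φ.1
  rw [h, map_neg]
  abel

theorem finrank_lieH2_eq_one {k L M : Type*} [Field k] [LieRing L] [LieAlgebra k L]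
    [AddCommGroup M] [Module k M] [LieRingModule L M] [LieModule k L M] {F : twoCocycle k L M}
    (hF : F ∉ twoCoboundary k L M) (h : ∀ φ : twoCocycle k L M,
      ∃ (c : k) (ψ : oneCochain k L M), φ.1 = c • F.1 + d₁₂ k L M ψ) :
    Module.finrank k (LieH2 k L M) = 1 := by
  have : Module.Free k (LieH2 k L M) := .of_divisionRing k _
  rw [finrank_eq_one_iff']
  refine ⟨(twoCoboundary k L M).mkQ F, fun h => ?_, fun w => ?_⟩
  · rw [Submodule.mkQ_apply, Submodule.Quotient.mk_eq_zero] at h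
    exact hF h
  · exact Submodule.mem_span_singleton.mp (span_mkQ_twoCocycle h ▸ Submodule.mem_top)

end LieDerivative

section InvariantCocycle

open Matrix Kronecker

/-- Every 2-cocycle is cohomologous to one invariant under the `g i`, if these act on `L` by
skew-Hermitian matrices `S i`, both on the spanning family `b` and on the coordinates `T`. -/
theorem exists_invariant_cocycle {L ι κ : Type*} [LieRing L] [LieAlgebra ℂ L]
    [FiniteDimensional ℂ L] [Fintype ι] [Fintype κ] [DecidableEq κ] (g : ι → L) (b : κ → L)
    (hb : Submodule.span ℂ (Set.range b) = ⊤) (T : L →ₗ[ℂ] (κ → ℂ)) (hT : Function.Injective T)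
    (S : ι → Matrix κ κ ℂ) (hS : ∀ i, (S i)ᴴ = -S i)
    (hgb : ∀ i a, ⁅g i, b a⁆ = ∑ d, S i d a • b d) (hgT : ∀ i x, T ⁅g i, x⁆ = S i *ᵥ T x)
    (φ : twoCocycle ℂ L L) : ∃ φ₀ : twoCocycle ℂ L L, φ - φ₀ ∈ twoCoboundary ℂ L L ∧
      ∀ i, lieDerivative ℂ L L (g i) φ₀ = 0 := by
  let C : twoCocycle ℂ L L →ₗ[ℂ] (κ × κ × κ → ℂ) :=
    { toFun := fun φ p => T (φ.1 (b p.1) (b p.2.1)) p.2.2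
      map_add' := fun φ χ => funext fun p =>
        congrFun (map_add T (φ.1 (b p.1) (b p.2.1)) (χ.1 (b p.1) (b p.2.1))) p.2.2
      map_smul' := fun t φ => funext fun p =>
        congrFun (map_smul T t (φ.1 (b p.1) (b p.2.1))) p.2.2 }
  have hC : Function.Injective C := by
    rw [injective_iff_map_eq_zero]
    intro φ hφ
    apply Subtype.ext
    apply Subtype.ext
    refine LinearMap.ext_on_range hb fun a => LinearMap.ext_on_range hb fun a' => ?_
    refine hT (funext fun c => ?_)
    exact (congrFun hφ (a, a', c)).trans (congrFun (map_zero T) c).symm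
  let K (i : ι) : Matrix (κ × κ × κ) (κ × κ × κ) ℂ :=
    (1 : Matrix κ κ ℂ) ⊗ₖ ((1 : Matrix κ κ ℂ) ⊗ₖ S i)
      - (S i)ᵀ ⊗ₖ ((1 : Matrix κ κ ℂ) ⊗ₖ (1 : Matrix κ κ ℂ))
      - (1 : Matrix κ κ ℂ) ⊗ₖ ((S i)ᵀ ⊗ₖ (1 : Matrix κ κ ℂ))
  have hK (i : ι) : (K i)ᴴ = -K i := by
    have hS' : (S i)ᵀᴴ = -(S i)ᵀ := by
      rw [← transpose_neg, ← hS]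
      rfl
    ext p q
    simp only [K, conjTranspose_sub, conjTranspose_kronecker, conjTranspose_one, hS, hS',
      Matrix.sub_apply, Matrix.neg_apply, kroneckerMap_apply]
    ring
  have hCK (i : ι) (φ : twoCocycle ℂ L L) : C (lieDerivative ℂ L L (g i) φ) = K i *ᵥ C φ := by
    ext ⟨a, a', c⟩
    change T ((lieDerivative ℂ L L (g i) φ).1 (b a) (b a')) c = _
    rw [lieDerivative_apply, map_sub, map_sub, hgT, hgb, hgb, map_sum, map_sum,
      LinearMap.sum_apply]
    simp only [map_smul, LinearMap.smul_apply, map_sum]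
    simp only [Pi.sub_apply, Finset.sum_apply, Pi.smul_apply, K, mulVec, Matrix.sub_apply,
      sub_mul, Finset.sum_sub_distrib, dotProduct,
      Fintype.sum_prod_type, kroneckerMap_apply, transpose_apply, one_apply, ite_mul, one_mul,
      mul_ite, mul_one, mul_zero, zero_mul, Finset.sum_ite_eq, Finset.mem_univ,
      if_true, smul_eq_mul, Finset.sum_ite_irrel, Finset.sum_const_zero]
    rfl
  obtain ⟨φ₀, w, h, h₀⟩ := exists_eq_add_sum_sq (fun i => lieDerivative ℂ L L (g i)) C hC K hK hCK φ
  refine ⟨φ₀, ?_, h₀⟩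
  rw [h, add_sub_cancel_left]
  exact Submodule.sum_mem _ fun i _ => lieDerivative_mem_twoCoboundary _ _

end InvariantCocycle

/-! ### The second cohomology of `𝔢ₙ` -/

section EuclideanCohomology

variable {n : ℕ}

/-- The spanning family of `𝔢ₙ` formed by all `lⱼᵢ` (each thus occurring twice, up to sign) and
all `eₖ`. -/
def euclFrame (n : ℕ) : (Fin n × Fin n) ⊕ Fin n → EuclAlg n :=
  Sum.elim (fun p => rotIncl n (lMat p.2 p.1)) (fun k => transIncl n (eVec k))

/-- The coordinates of `(u, A)` in `𝔢ₙ`: the matrix entries of `A` and the components of `u`. -/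
def euclCoord (n : ℕ) : EuclAlg n →ₗ[ℂ] ((Fin n × Fin n) ⊕ Fin n → ℂ) where
  toFun x := Sum.elim (fun p => x.right.1 p.1 p.2) (transCoord n x.left)
  map_add' x y := by ext (p | k) <;> rfl
  map_smul' t x := by ext (p | k) <;> rfl

/-- The matrix of `ad A`, for `A` in `𝔬(n, ℂ)`, on the family `euclFrame` and on the coordinates
`euclCoord`. -/
def rotMatrix (A : OrthAlg n) :
    Matrix ((Fin n × Fin n) ⊕ Fin n) ((Fin n × Fin n) ⊕ Fin n) ℂ :=
  Matrix.fromBlocks (Matrix.of fun p q => A.1 p.1 q.1 * (if q.2 = p.2 then 1 else 0)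
    + A.1 p.2 q.2 * (if q.1 = p.1 then 1 else 0)) 0 0 A.1

theorem euclCoord_injective : Function.Injective (euclCoord n) := fun x y h => by
  refine LieAlgebra.SemiDirectSum.ext ?_ ?_
  · exact (transCoord n).injective (funext fun k => congrFun h (Sum.inr k))
  · ext i j
    exact congrFun h (Sum.inl (i, j))

instance : FiniteDimensional ℂ (EuclAlg n) := .of_injective (euclCoord n) euclCoord_injective

theorem span_range_euclFrame : Submodule.span ℂ (Set.range (euclFrame n)) = ⊤ := by
  rw [eq_top_iff]
  intro x _
  rw [x.eq_transIncl_add_rotIncl, x.left.eq_sum_eVec, x.right.eq_sum_lMat]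
  simp only [map_sum, map_smul]
  refine Submodule.add_mem _ (Submodule.sum_mem _ fun i _ => ?_)
    (Submodule.sum_mem _ fun i _ => Submodule.sum_mem _ fun j _ => ?_)
  · exact Submodule.smul_mem _ _ (Submodule.subset_span ⟨Sum.inr i, rfl⟩)
  · exact Submodule.smul_mem _ _ (Submodule.subset_span ⟨Sum.inl (j, i), rfl⟩)

theorem rotMatrix_lMat_conjTranspose (i j : Fin n) :
    (rotMatrix (lMat i j : OrthAlg n)).conjTranspose = -rotMatrix (lMat i j) := by
  have h (a b : Fin n) :
      star ((lMat i j : OrthAlg n).1 a b) = -(lMat i j : OrthAlg n).1 b a := by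
    rw [← OrthAlg.apply_swap, lMat_apply]
    simp only [star_sub, star_mul', apply_ite star, star_one, star_zero]
  ext (⟨a, b⟩ | k) (⟨c, d⟩ | k')
  · simp only [rotMatrix, Matrix.conjTranspose_apply, Matrix.fromBlocks_apply₁₁, Matrix.of_apply,
      Matrix.neg_apply, star_add, star_mul', h, apply_ite star, star_one, star_zero,
      eq_comm (a := b), eq_comm (a := a)]
    ring
  · simp [rotMatrix]
  · simp [rotMatrix]
  · simp only [rotMatrix, Matrix.conjTranspose_apply, Matrix.fromBlocks_apply₂₂,
      Matrix.neg_apply, h]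

theorem rotationAction_eVec (A : OrthAlg n) (i : Fin n) :
    rotationAction n A (eVec i) = ∑ k, A.1 k i • eVec k := by
  rw [TransAlg.eq_sum_eVec (rotationAction n A (eVec i))]
  refine Finset.sum_congr rfl fun k _ => ?_
  rw [transCoord_rotationAction]
  simp [eVec]

theorem lie_rotIncl_euclFrame (A : OrthAlg n) (a : (Fin n × Fin n) ⊕ Fin n) :
    ⁅rotIncl n A, euclFrame n a⁆ = ∑ d, rotMatrix A d a • euclFrame n d := by
  rcases a with ⟨i, j⟩ | k
  · rw [Fintype.sum_sum_type]
    simp only [euclFrame, Sum.elim_inl, Sum.elim_inr, rotMatrix, Matrix.fromBlocks_apply₁₁,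
      Matrix.fromBlocks_apply₂₁, Matrix.zero_apply, zero_smul, Finset.sum_const_zero, add_zero,
      Matrix.of_apply, Fintype.sum_prod_type, add_smul, Finset.sum_add_distrib, mul_ite, mul_one,
      mul_zero, ite_smul, Finset.sum_ite_eq, Finset.sum_ite_irrel, Finset.mem_univ, if_true]
    rw [lie_rotIncl_rotIncl, ← wedge_eVec, lie_wedge, rotationAction_eVec, rotationAction_eVec,
      map_sum, map_sum, LinearMap.sum_apply, map_add, map_sum, map_sum, add_comm]
    simp only [map_smul, LinearMap.smul_apply, wedge_eVec]
  · rw [Fintype.sum_sum_type]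
    simp only [euclFrame, Sum.elim_inl, Sum.elim_inr, rotMatrix, Matrix.fromBlocks_apply₁₂,
      Matrix.fromBlocks_apply₂₂, Matrix.zero_apply, zero_smul, Finset.sum_const_zero, zero_add]
    rw [lie_rotIncl_transIncl, rotationAction_eVec, map_sum]
    simp only [map_smul]

theorem euclCoord_lie_rotIncl (A : OrthAlg n) (x : EuclAlg n) :
    euclCoord n ⁅rotIncl n A, x⁆ = (rotMatrix A).mulVec (euclCoord n x) := by
  ext (⟨i, j⟩ | k)
  · change (⁅A, x.right⁆ : OrthAlg n).1 i j = _
    simp only [rotMatrix, Matrix.mulVec, dotProduct, Fintype.sum_sum_type,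
      Matrix.fromBlocks_apply₁₁, Matrix.fromBlocks_apply₁₂, Matrix.zero_apply, zero_mul,
      Finset.sum_const_zero, add_zero, Matrix.of_apply, Fintype.sum_prod_type, add_mul,
      Finset.sum_add_distrib, mul_ite, mul_one, mul_zero, ite_mul, Finset.sum_ite_eq',
      Finset.sum_ite_irrel, Finset.mem_univ, if_true]
    rw [OrthAlg.lie_apply, sub_eq_add_neg, ← Finset.sum_neg_distrib]
    congr 1
    refine Finset.sum_congr rfl fun c _ => ?_
    rw [A.apply_swap j c]
    change -(x.right.1 i c * -A.1 j c) = A.1 j c * x.right.1 i c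
    ring
  · have h : (⁅rotIncl n A, x⁆ : EuclAlg n).left = rotationAction n A x.left := by
      rw [EuclAlg.lie_left]
      exact (congrArg _ (map_zero _)).trans (sub_zero _)
    change transCoord n (⁅rotIncl n A, x⁆ : EuclAlg n).left k = _
    rw [h, transCoord_rotationAction]
    simp only [rotMatrix, Matrix.mulVec, dotProduct, Fintype.sum_sum_type,
      Matrix.fromBlocks_apply₂₁, Matrix.fromBlocks_apply₂₂, Matrix.zero_apply, zero_mul,
      Finset.sum_const_zero, zero_add]
    rfl

set_option maxHeartbeats 800000 in
theorem exists_rotInvariant_cocycle (φ : twoCocycle ℂ (EuclAlg n) (EuclAlg n)) :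
    ∃ φ₀, φ - φ₀ ∈ twoCoboundary ℂ (EuclAlg n) (EuclAlg n) ∧
      ∀ A, lieDerivative ℂ (EuclAlg n) (EuclAlg n) (rotIncl n A) φ₀ = 0 := by
  obtain ⟨φ₀, h, h₀⟩ := exists_invariant_cocycle
    (fun p : Fin n × Fin n => rotIncl n (lMat p.1 p.2)) (euclFrame n) span_range_euclFrame
    (euclCoord n) euclCoord_injective (fun p => rotMatrix (lMat p.1 p.2))
    (fun p => rotMatrix_lMat_conjTranspose p.1 p.2) (fun p => lie_rotIncl_euclFrame _)
    (fun p => euclCoord_lie_rotIncl _) φ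
  refine ⟨φ₀, h, fun A => ?_⟩
  rw [A.eq_sum_lMat]
  simp only [map_sum, map_smul, LinearMap.sum_apply, LinearMap.smul_apply]
  exact Finset.sum_eq_zero fun i _ => Finset.sum_eq_zero fun j _ => by rw [h₀ (i, j), smul_zero]

/-- An `𝔬(n, ℂ)`-invariant cocycle restricts on `𝔬(n, ℂ)` to inner derivations of `𝔢ₙ`: it does so
on commutators, and `𝔬(n, ℂ)` is perfect. -/
theorem exists_inner_of_rotInvariant (hn : 3 ≤ n) (φ : twoCocycle ℂ (EuclAlg n) (EuclAlg n))
    (h : ∀ A, lieDerivative ℂ (EuclAlg n) (EuclAlg n) (rotIncl n A) φ = 0) :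
    ∃ D : OrthAlg n →ₗ[ℂ] EuclAlg n, ∀ A z, φ.1 (rotIncl n A) z = ⁅D A, z⁆ := by
  have hex (A : OrthAlg n) : ∃ d : EuclAlg n, ∀ z, φ.1 (rotIncl n A) z = ⁅d, z⁆ := by
    have hl (i j : Fin n) : ∃ d : EuclAlg n, ∀ z, φ.1 (rotIncl n (lMat i j)) z = ⁅d, z⁆ := by
      obtain ⟨B, C, hBC⟩ := lMat_eq_lie hn i j
      refine ⟨φ.1 (rotIncl n B) (rotIncl n C), fun z => ?_⟩
      rw [hBC, ← lie_rotIncl_rotIncl, cocycle_lie_eq φ (h B) (h C)]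
    choose d hd using hl
    refine ⟨∑ i, ∑ j, ((1 / 2 : ℂ) * A.1 j i) • d i j, fun z => ?_⟩
    conv_lhs => rw [A.eq_sum_lMat]
    simp only [map_sum, map_smul, LinearMap.sum_apply, LinearMap.smul_apply, hd, sum_lie,
      smul_lie]
  choose D hD using hex
  have huniq {d e : EuclAlg n} (hde : ∀ z : EuclAlg n, ⁅d, z⁆ = ⁅e, z⁆) : d = e :=
    sub_eq_zero.mp <| EuclAlg.eq_zero_of_lie_eq_zero (by omega) fun z => by
      rw [sub_lie, hde, sub_self]
  have hadd (A B : OrthAlg n) : D (A + B) = D A + D B := huniq fun z => by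
    rw [← hD, add_lie (D A) (D B) z, ← hD, ← hD, map_add, map_add, LinearMap.add_apply]
  have hsmul (t : ℂ) (A : OrthAlg n) : D (t • A) = t • D A := huniq fun z => by
    rw [← hD, smul_lie t (D A) z, ← hD, map_smul, map_smul, LinearMap.smul_apply]
  exact ⟨⟨⟨D, hadd⟩, hsmul⟩, hD⟩

/-- An invariant cocycle is cohomologous to one vanishing on `𝔬(n, ℂ)`: if `φ(A, z) = [D A, z]`,
then `D`, extended by zero to `ℂⁿ`, is a cochain with the same values on `𝔬(n, ℂ)`. -/
theorem exists_relative_cocycle (hn : 3 ≤ n) (φ : twoCocycle ℂ (EuclAlg n) (EuclAlg n))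
    (h : ∀ A, lieDerivative ℂ (EuclAlg n) (EuclAlg n) (rotIncl n A) φ = 0) :
    ∃ φ', φ - φ' ∈ twoCoboundary ℂ (EuclAlg n) (EuclAlg n) ∧ ∀ A, φ'.1 (rotIncl n A) = 0 := by
  obtain ⟨D, hD⟩ := exists_inner_of_rotInvariant hn φ h
  have hDlie (A B : OrthAlg n) : D ⁅A, B⁆ = ⁅rotIncl n A, D B⁆ := by
    have h1 : D ⁅A, B⁆ = φ.1 (rotIncl n A) (rotIncl n B) :=
      sub_eq_zero.mp <| EuclAlg.eq_zero_of_lie_eq_zero (by omega) fun z => by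
        rw [sub_lie, ← hD, ← lie_rotIncl_rotIncl, cocycle_lie_eq φ (h A) (h B), sub_self]
    rw [h1, ← twoCochain_skew, hD, lie_skew]
  let ψ : oneCochain ℂ (EuclAlg n) (EuclAlg n) :=
    D ∘ₗ (LieAlgebra.SemiDirectSum.projr (rotationAction n)).toLinearMap
  refine ⟨φ - ⟨d₁₂ ℂ _ _ ψ, d₁₂_mem_twoCocycle ψ⟩, ?_, fun A => LinearMap.ext fun z => ?_⟩
  · rw [sub_sub_cancel]
    exact mem_twoCoboundary_iff.mpr ⟨ψ, rfl⟩
  · change φ.1 (rotIncl n A) z - (⁅rotIncl n A, D z.right⁆ - ⁅z, D A⁆ - D ⁅A, z.right⁆) = 0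
    rw [hD, hDlie, ← lie_skew z]
    abel

set_option maxHeartbeats 800000 in
/-- A cocycle vanishing on `𝔬(n, ℂ)` restricts to an invariant cocycle on `ℂⁿ`. Its curvature is a
multiple of `wedge`, and the connection of its torsion is equivariant, so that its extension by zero
to `𝔬(n, ℂ)` has the right coboundary on all of `𝔢ₙ`. -/
theorem cocycle_eq_of_relative (hn : 2 ≤ n) (φ : twoCocycle ℂ (EuclAlg n) (EuclAlg n))
    (h : ∀ A, φ.1 (rotIncl n A) = 0) :
    ∃ (c : ℂ) (ψ : oneCochain ℂ (EuclAlg n) (EuclAlg n)),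
      φ.1 = c • euclCochain n + d₁₂ ℂ (EuclAlg n) (EuclAlg n) ψ := by
  let f : TransAlg n →ₗ[ℂ] TransAlg n →ₗ[ℂ] EuclAlg n :=
    φ.1.1.compl₁₂ (transIncl n) (transIncl n)
  have hfa (u v : TransAlg n) : f u v = φ.1 (transIncl n u) (transIncl n v) := rfl
  have hf : IsTransCocycle f :=
    { alternating := fun u => twoCochain_alt φ.1 _
      cocycle := fun u v w => by
        have := cocycle_identity φ (transIncl n u) (transIncl n v) (transIncl n w)
        rw [lie_transIncl_transIncl, lie_transIncl_transIncl, lie_transIncl_transIncl, map_zero,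
          LinearMap.zero_apply, LinearMap.zero_apply, LinearMap.zero_apply, sub_zero, add_zero,
          sub_zero] at this
        exact this }
  -- By Cartan's formula a cocycle vanishing on `𝔬(n, ℂ)` is invariant under it.
  have hinv (g : OrthAlg n) (u v : TransAlg n) : ⁅rotIncl n g, f u v⁆ =
      f (rotationAction n g u) v + f u (rotationAction n g v) := by
    have h1 : lieDerivative ℂ (EuclAlg n) (EuclAlg n) (rotIncl n g) φ = 0 :=
      Subtype.ext <| (congrArg (d₁₂ ℂ _ _) (h g)).trans (map_zero _)
    have h2 : (lieDerivative ℂ (EuclAlg n) (EuclAlg n) (rotIncl n g) φ).1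
      (transIncl n u) (transIncl n v) = 0 := by rw [h1]; rfl
    rw [lieDerivative_apply, lie_rotIncl_transIncl, lie_rotIncl_transIncl, sub_sub] at h2
    exact sub_eq_zero.mp h2
  obtain ⟨c, l, hl⟩ := hf.exists_decomposition hn fun g u v =>
    congrArg LieAlgebra.SemiDirectSum.right (hinv g u v)
  -- The `ℂⁿ`-component of `f` is a torsion, with connection `l`.
  have hleft (u v : TransAlg n) :
      (f u v).left = rotationAction n (l u) v - rotationAction n (l v) u := by
    rw [hl, rotCocycle_eq_rotIncl_wedge, ← map_smul]
    exact zero_add _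
  have hequiv := map_rotationAction_of_torsion l fun g u v => by
    have h1 := congrArg LieAlgebra.SemiDirectSum.left (hinv g u v)
    have h2 : (⁅rotIncl n g, f u v⁆ : EuclAlg n).left = rotationAction n g (f u v).left := by
      rw [EuclAlg.lie_left]
      exact (congrArg _ (map_zero _)).trans (sub_zero _)
    rw [h2] at h1
    change _ = (f (rotationAction n g u) v).left + (f u (rotationAction n g v)).left at h1
    simpa only [hleft] using h1
  let ψ : oneCochain ℂ (EuclAlg n) (EuclAlg n) :=
    rotIncl n ∘ₗ l ∘ₗ LieAlgebra.SemiDirectSum.projl (rotationAction n)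
  have hψ (x : EuclAlg n) : ψ x = rotIncl n (l x.left) := rfl
  refine ⟨c, ψ, ?_⟩
  apply DFunLike.ext
  intro x
  refine LinearMap.ext fun y => ?_
  have hxy : φ.1 x y = f x.left y.left := by
    have h' (A : OrthAlg n) (z : EuclAlg n) : φ.1 z (rotIncl n A) = 0 := by
      rw [← twoCochain_skew, h, LinearMap.zero_apply, neg_zero]
    conv_lhs => rw [x.eq_transIncl_add_rotIncl, y.eq_transIncl_add_rotIncl]
    rw [map_add (φ.1 _), h', add_zero, map_add, h, add_zero, hfa]
  rw [hxy, hl, add_apply_apply, smul_apply_apply]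
  congr 1
  rw [d₁₂_apply_apply, hψ, hψ, hψ]
  refine LieAlgebra.SemiDirectSum.ext ?_ ?_
  · change _ = (⁅x, rotIncl n (l y.left)⁆ : EuclAlg n).left
      - (⁅y, rotIncl n (l x.left)⁆ : EuclAlg n).left - 0
    rw [EuclAlg.lie_left, EuclAlg.lie_left]
    change rotationAction n (l x.left) y.left - rotationAction n (l y.left) x.left =
      rotationAction n x.right 0 - rotationAction n (l y.left) x.left
      - (rotationAction n y.right 0 - rotationAction n (l x.left) y.left) - 0
    rw [map_zero, map_zero]
    abel
  · change 0 = ⁅x.right, l y.left⁆ - ⁅y.right, l x.left⁆ - l (⁅x, y⁆ : EuclAlg n).left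
    rw [EuclAlg.lie_left, map_sub, hequiv, hequiv, sub_self]

theorem euclCochain_apply (x y : EuclAlg n) :
    euclCochain n x y = rotIncl n (wedge n x.left y.left) := rotCocycle_eq_rotIncl_wedge _ _

/-- In the `ℂⁿ`-component this is the Bianchi identity for `wedge`, in the `𝔬(n, ℂ)`-component the
equivariance of `wedge`. -/
theorem euclCochain_mem_twoCocycle : euclCochain n ∈ twoCocycle ℂ (EuclAlg n) (EuclAlg n) := by
  rw [mem_twoCocycle_iff]
  refine LinearMap.ext fun x => LinearMap.ext fun y => LinearMap.ext fun z => ?_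
  rw [d₂₃_apply]
  simp only [euclCochain_apply, EuclAlg.lie_left]
  have hs (u v : TransAlg n) : wedge n u v = -wedge n v u :=
    (LinearMap.IsAlt.neg (B := wedge n) wedge_self v u).symm
  have hleft (x : EuclAlg n) (A : OrthAlg n) :
      (⁅x, rotIncl n A⁆ : EuclAlg n).left = -rotationAction n A x.left := by
    rw [EuclAlg.lie_left]
    exact (congrArg (· - _) (map_zero _)).trans (zero_sub _)
  refine LieAlgebra.SemiDirectSum.ext ?_ ?_
  · change (⁅x, rotIncl n _⁆ : EuclAlg n).left - (⁅y, rotIncl n _⁆ : EuclAlg n).left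
      + (⁅z, rotIncl n _⁆ : EuclAlg n).left - 0 + 0 - 0 = 0
    rw [hleft, hleft, hleft, hs x.left z.left, map_neg, LieDerivation.coe_neg, Pi.neg_apply,
      sub_zero, add_zero, sub_zero, ← neg_zero, ← wedge_bianchi x.left y.left z.left]
    abel
  · change ⁅x.right, wedge n y.left z.left⁆ - ⁅y.right, wedge n x.left z.left⁆
      + ⁅z.right, wedge n x.left y.left⁆ - wedge n _ z.left + wedge n _ y.left
      - wedge n _ x.left = 0
    simp only [lie_wedge, map_sub, LinearMap.sub_apply]
    rw [hs y.left (rotationAction n x.right z.left), hs x.left (rotationAction n y.right z.left),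
      hs x.left (rotationAction n z.right y.left)]
    abel

set_option maxHeartbeats 800000 in
theorem exists_cocycle_eq (hn : 3 ≤ n) (φ : twoCocycle ℂ (EuclAlg n) (EuclAlg n)) :
    ∃ (c : ℂ) (ψ : oneCochain ℂ (EuclAlg n) (EuclAlg n)),
      φ.1 = c • euclCochain n + d₁₂ ℂ (EuclAlg n) (EuclAlg n) ψ := by
  obtain ⟨φ₀, hφ₀, hinv⟩ := exists_rotInvariant_cocycle φ
  obtain ⟨φ₁, hφ₁, hrel⟩ := exists_relative_cocycle hn φ₀ hinv
  obtain ⟨ψ₀, h₀⟩ := mem_twoCoboundary_iff.mp hφ₀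
  obtain ⟨ψ₁, h₁⟩ := mem_twoCoboundary_iff.mp hφ₁
  obtain ⟨c, ψ, h⟩ := cocycle_eq_of_relative (by omega) φ₁ hrel
  refine ⟨c, ψ + ψ₁ + ψ₀, ?_⟩
  rw [map_add, map_add, h₀, h₁, ← add_assoc, ← add_assoc, ← h]
  change φ.1 = φ₁.1 + (φ₀.1 - φ₁.1) + (φ.1 - φ₀.1)
  abel

theorem not_mem_twoCoboundary_euclCochain (hn : 2 ≤ n) :
    (⟨euclCochain n, euclCochain_mem_twoCocycle⟩ : twoCocycle ℂ (EuclAlg n) (EuclAlg n)) ∉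
      twoCoboundary ℂ (EuclAlg n) (EuclAlg n) := by
  intro h
  obtain ⟨ψ, hψ⟩ := mem_twoCoboundary_iff.mp h
  refine not_isTransCoboundary_rotCocycle hn ⟨ψ ∘ₗ transIncl n, fun u v => ?_⟩
  have h1 : d₁₂ ℂ (EuclAlg n) (EuclAlg n) ψ (transIncl n u) (transIncl n v) =
    euclCochain n (transIncl n u) (transIncl n v) := by rw [hψ]
  rw [d₁₂_apply_apply, lie_transIncl_transIncl, map_zero, sub_zero,
    ← lie_skew (transIncl n v), sub_neg_eq_add, add_comm] at h1
  exact h1.symm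

end EuclideanCohomology

/-! ### Formal deformations by gauge transformation -/

section Gauge

variable {R L : Type*} [CommRing R] [LieRing L] [LieAlgebra R L]

variable (R L) in
/-- The bracket of `L` as a 2-cochain. -/
def bracketCochain : twoCochain R L L := ⟨lieBracketMap R L, lie_self⟩

/-- The 2-cochain `(x, y) ↦ B(x, ψ y) + B(ψ x, y)`. -/
def polarization (ψ : L →ₗ[R] L) (B : twoCochain R L L) : twoCochain R L L :=
  ⟨B.1.compl₂ ψ + B.1 ∘ₗ ψ, fun x => by
    change B x (ψ x) + B (ψ x) x = 0
    rw [← twoCochain_skew B x, add_neg_cancel]⟩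

/-- The 2-cochain `(x, y) ↦ B(ψ x, ψ y)`. -/
def pullbackCochain (ψ : L →ₗ[R] L) (B : twoCochain R L L) : twoCochain R L L :=
  ⟨B.1.compl₁₂ ψ ψ, fun x => twoCochain_alt B (ψ x)⟩

/-- The 2-cochain `(x, y) ↦ ψ (B(x, y))`. -/
def postcompCochain (ψ : L →ₗ[R] L) (B : twoCochain R L L) : twoCochain R L L :=
  ⟨B.1.compr₂ ψ, fun x => (congrArg ψ (twoCochain_alt B x)).trans (map_zero ψ)⟩

/-- The coefficients of `tᵏ` in `[g x, g y] + t F(g x, g y)`, where `g = 1 + t ψ`. -/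
def gaugePolynomial (F : twoCochain R L L) (ψ : L →ₗ[R] L) : ℕ → twoCochain R L L
  | 0 => bracketCochain R L
  | 1 => polarization ψ (bracketCochain R L) + F
  | 2 => pullbackCochain ψ (bracketCochain R L) + polarization ψ F
  | 3 => pullbackCochain ψ F
  | _ + 4 => 0

/-- The coefficients of `tᵏ` in `[g x, y] + t F(g x, y)`, where `g = 1 + t ψ`. -/
def halfGaugePolynomial (F : twoCochain R L L) (ψ : L →ₗ[R] L) : ℕ → L →ₗ[R] L →ₗ[R] L
  | 0 => lieBracketMap R L
  | 1 => lieBracketMap R L ∘ₗ ψ + F.1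
  | 2 => F.1 ∘ₗ ψ
  | _ + 3 => 0

/-- The transform `g⁻¹([g x, g y] + t F(g x, g y))` of the bracket `[·,·] + t F` by the formal
automorphism `g = 1 + t ψ`. As `g⁻¹ = ∑ₖ (-t ψ)ᵏ`, its coefficients `φₖ` are given by
`φₖ₊₁ + ψ ∘ φₖ = gaugePolynomial F ψ (k + 1)`. -/
def gaugeTransform (F : twoCochain R L L) (ψ : L →ₗ[R] L) : ℕ → twoCochain R L L
  | 0 => bracketCochain R L
  | k + 1 => gaugePolynomial F ψ (k + 1) - postcompCochain ψ (gaugeTransform F ψ k)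

variable (F : twoCochain R L L) (ψ : L →ₗ[R] L)

theorem gaugeTransform_succ (k : ℕ) (x y : L) : gaugeTransform F ψ (k + 1) x y
    + ψ (gaugeTransform F ψ k x y) = gaugePolynomial F ψ (k + 1) x y :=
  sub_add_cancel _ _

theorem gaugePolynomial_succ (k : ℕ) (x y : L) : gaugePolynomial F ψ (k + 1) x y =
    halfGaugePolynomial F ψ (k + 1) x y + halfGaugePolynomial F ψ k x (ψ y) := by
  match k with
  | 0 =>
    change ⁅x, ψ y⁆ + ⁅ψ x, y⁆ + F x y = ⁅ψ x, y⁆ + F x y + ⁅x, ψ y⁆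
    abel
  | 1 =>
    change ⁅ψ x, ψ y⁆ + (F x (ψ y) + F (ψ x) y) = F (ψ x) y + (⁅ψ x, ψ y⁆ + F x (ψ y))
    abel
  | 2 => exact (zero_add _).symm
  | _ + 3 => exact (add_zero _).symm

/-- The coefficient identity of `g [x, [y, z]]' = μ(g x, μ(g y, g z))`, where `[·,·]'` is the
transform of `μ = [·,·] + t F`. -/
theorem gaugeTransform_comp_succ (k : ℕ) (x y z : L) :
    ∑ p ∈ Finset.HasAntidiagonal.antidiagonal (k + 1),
        gaugeTransform F ψ p.1 x (gaugeTransform F ψ p.2 y z)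
      + ψ (∑ p ∈ Finset.HasAntidiagonal.antidiagonal k,
        gaugeTransform F ψ p.1 x (gaugeTransform F ψ p.2 y z)) =
    ∑ p ∈ Finset.HasAntidiagonal.antidiagonal (k + 1),
      halfGaugePolynomial F ψ p.1 x (gaugePolynomial F ψ p.2 y z) := by
  have h0 (w : L) : gaugeTransform F ψ 0 x w = halfGaugePolynomial F ψ 0 x w := rfl
  rw [Finset.Nat.sum_antidiagonal_succ, add_assoc, map_sum, ← Finset.sum_add_distrib]
  simp only [gaugeTransform_succ, gaugePolynomial_succ F ψ _ x, Finset.sum_add_distrib, h0]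
  rw [← add_assoc, ← Finset.Nat.sum_antidiagonal_succ
    (f := fun p => halfGaugePolynomial F ψ p.1 x (gaugeTransform F ψ p.2 y z)),
    Finset.Nat.sum_antidiagonal_succ', Finset.Nat.sum_antidiagonal_succ', add_assoc,
    ← Finset.sum_add_distrib]
  simp only [← map_add, gaugeTransform_succ]
  rfl

variable {F}

/-- The Jacobi identity of `[·,·] + t F` at `g x`, `g y`, `g z`, in each degree in `t`. -/
theorem gaugePolynomial_jacobi (hF : F ∈ twoCocycle R L L)
    (hFF : ∀ x y z, F x (F y z) + F y (F z x) + F z (F x y) = 0) (k : ℕ) (x y z : L) :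
    ∑ p ∈ Finset.HasAntidiagonal.antidiagonal k,
        halfGaugePolynomial F ψ p.1 x (gaugePolynomial F ψ p.2 y z)
      + ∑ p ∈ Finset.HasAntidiagonal.antidiagonal k,
        halfGaugePolynomial F ψ p.1 y (gaugePolynomial F ψ p.2 z x)
      + ∑ p ∈ Finset.HasAntidiagonal.antidiagonal k,
        halfGaugePolynomial F ψ p.1 z (gaugePolynomial F ψ p.2 x y) = 0 := by
  have J1 (x y z : L) : ⁅x, ⁅y, z⁆⁆ + ⁅y, ⁅z, x⁆⁆ + ⁅z, ⁅x, y⁆⁆ = 0 := lie_jacobi x y z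
  have J2 := cocycle_cyclic hF
  have hN0 (x w : L) : halfGaugePolynomial F ψ 0 x w = ⁅x, w⁆ := rfl
  have hN1 (x w : L) : halfGaugePolynomial F ψ 1 x w = ⁅ψ x, w⁆ + F x w := rfl
  have hN2 (x w : L) : halfGaugePolynomial F ψ 2 x w = F (ψ x) w := rfl
  have hM0 (x y : L) : gaugePolynomial F ψ 0 x y = ⁅x, y⁆ := rfl
  have hM1 (x y : L) : gaugePolynomial F ψ 1 x y = ⁅x, ψ y⁆ + ⁅ψ x, y⁆ + F x y := rfl
  have hM2 (x y : L) : gaugePolynomial F ψ 2 x y = ⁅ψ x, ψ y⁆ + (F x (ψ y) + F (ψ x) y) := rfl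
  have hM3 (x y : L) : gaugePolynomial F ψ 3 x y = F (ψ x) (ψ y) := rfl
  have hM4 (k : ℕ) (x y : L) : gaugePolynomial F ψ (k + 4) x y = 0 := rfl
  have hsum (k : ℕ) (x y z : L) : ∑ p ∈ Finset.HasAntidiagonal.antidiagonal (k + 2),
      halfGaugePolynomial F ψ p.1 x (gaugePolynomial F ψ p.2 y z) =
      ⁅x, gaugePolynomial F ψ (k + 2) y z⁆ + (⁅ψ x, gaugePolynomial F ψ (k + 1) y z⁆
        + F x (gaugePolynomial F ψ (k + 1) y z)) + F (ψ x) (gaugePolynomial F ψ k y z) := by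
    rw [Finset.Nat.sum_antidiagonal_succ, Finset.Nat.sum_antidiagonal_succ, ← add_assoc,
      ← hN0, ← hN1, ← hN2]
    congr 1
    cases k with
    | zero => rw [Finset.Nat.antidiagonal_zero, Finset.sum_singleton]
    | succ k =>
      rw [Finset.Nat.sum_antidiagonal_succ]
      exact (congrArg _ (Finset.sum_eq_zero fun _ _ => rfl)).trans (add_zero _)
  have assemble {a b : L} (h : a = b) (hb : b = 0) : a = 0 := h.trans hb
  match k with
  | 0 => simpa only [Finset.Nat.antidiagonal_zero, Finset.sum_singleton, hN0, hM0] using J1 x y z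
  | 1 =>
    simp only [Finset.Nat.sum_antidiagonal_succ, Finset.Nat.antidiagonal_zero, Finset.sum_singleton,
      zero_add, hN0, hN1, hM0, hM1, lie_add]
    refine assemble ?_ (congrArg₂ (· + ·) (congrArg₂ (· + ·) (congrArg₂ (· + ·) (J1 (ψ x) y z)
      (J1 x (ψ y) z)) (J1 x y (ψ z))) (J2 x y z) |>.trans (by simp only [add_zero]))
    abel
  | 2 =>
    simp only [hsum 0, zero_add, hM0, hM1, hM2, lie_add, map_add]
    refine assemble ?_ (congrArg₂ (· + ·)
      (congrArg₂ (· + ·) (congrArg₂ (· + ·) (J1 x (ψ y) (ψ z)) (J1 (ψ x) y (ψ z)))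
        (J1 (ψ x) (ψ y) z)) (congrArg₂ (· + ·) (congrArg₂ (· + ·) (congrArg₂ (· + ·)
        (J2 (ψ x) y z) (J2 x (ψ y) z)) (J2 x y (ψ z))) (hFF x y z)) |>.trans
          (by simp only [add_zero]))
    abel
  | 3 =>
    simp only [hsum 1, Nat.reduceAdd, hM1, hM2, hM3, lie_add, map_add]
    refine assemble ?_ (congrArg₂ (· + ·) (congrArg₂ (· + ·) (J1 (ψ x) (ψ y) (ψ z))
      (congrArg₂ (· + ·) (congrArg₂ (· + ·) (J2 x (ψ y) (ψ z)) (J2 (ψ x) y (ψ z)))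
        (J2 (ψ x) (ψ y) z))) (congrArg₂ (· + ·) (congrArg₂ (· + ·)
        (hFF (ψ x) y z) (hFF x (ψ y) z)) (hFF x y (ψ z))) |>.trans (by simp only [add_zero]))
    abel
  | 4 =>
    simp only [hsum 2, Nat.reduceAdd, hM2, hM3, hM4 0, map_add, lie_zero, zero_add]
    refine assemble ?_ (congrArg₂ (· + ·) (J2 (ψ x) (ψ y) (ψ z)) (congrArg₂ (· + ·)
      (congrArg₂ (· + ·) (hFF x (ψ y) (ψ z)) (hFF (ψ x) y (ψ z))) (hFF (ψ x) (ψ y) z)) |>.trans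
        (by simp only [add_zero]))
    abel
  | 5 =>
    simp only [hsum 3, Nat.reduceAdd, hM3, hM4 0, hM4 1, lie_zero, map_zero, zero_add]
    exact hFF _ _ _
  | k + 6 =>
    simp only [hsum (k + 4), hM4 k, hM4 (k + 1), hM4 (k + 2), lie_zero, map_zero, add_zero]

theorem isFormalDeformation_gaugeTransform (hF : F ∈ twoCocycle R L L)
    (hFF : ∀ x y z, F x (F y z) + F y (F z x) + F z (F x y) = 0) :
    IsFormalDeformation (gaugeTransform F ψ) where
  zeroth _ _ := rfl
  jacobi k x y z := by
    simp only [Finset.sum_add_distrib]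
    induction k with
    | zero =>
      simp only [Finset.Nat.antidiagonal_zero, Finset.sum_singleton]
      exact lie_jacobi x y z
    | succ k ih =>
      have h := gaugePolynomial_jacobi ψ hF hFF (k + 1) x y z
      simp only [← gaugeTransform_comp_succ] at h
      have hψ := congrArg ψ ih
      rw [map_zero, map_add, map_add] at hψ
      rw [← h, eq_comm, ← sub_eq_zero, ← hψ]
      abel

/-- If `[·,·] + t F` is a Lie bracket, then every cocycle cohomologous to `F` is integrable. -/
theorem isIntegrable_of_eq_add_d₁₂ (hF : F ∈ twoCocycle R L L)
    (hFF : ∀ x y z, F x (F y z) + F y (F z x) + F z (F x y) = 0) (c : twoCocycle R L L)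
    (hc : c.1 = F + d₁₂ R L L ψ) : IsIntegrable c := by
  refine ⟨gaugeTransform F ψ, isFormalDeformation_gaugeTransform ψ hF hFF, ?_⟩
  rw [hc]
  refine DFunLike.ext _ _ fun x => LinearMap.ext fun y => ?_
  change ⁅x, ψ y⁆ + ⁅ψ x, y⁆ + F x y - ψ ⁅x, y⁆ = F x y + (⁅x, ψ y⁆ - ⁅y, ψ x⁆ - ψ ⁅x, y⁆)
  rw [← lie_skew y]
  abel

end Gauge

/-! ### The deformed bracket and `𝔬(n + 1, ℂ)` -/

section Deformed

variable {n : ℕ}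

/-- The values of `euclCochain` lie in `𝔬(n, ℂ)`, where it vanishes; hence the deformation is linear
in the parameter. -/
theorem euclCochain_comp_self (x y z : EuclAlg n) : euclCochain n x (euclCochain n y z) = 0 := by
  rw [euclCochain_apply, euclCochain_apply]
  change rotIncl n (wedge n x.left 0) = 0
  rw [map_zero, map_zero]

theorem isIntegrable_euclAlg (hn : 3 ≤ n) (c : twoCocycle ℂ (EuclAlg n) (EuclAlg n)) :
    IsIntegrable c := by
  obtain ⟨a, ψ, h⟩ := exists_cocycle_eq hn c
  refine isIntegrable_of_eq_add_d₁₂ ψ (F := a • euclCochain n)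
    (Submodule.smul_mem _ a euclCochain_mem_twoCocycle) (fun x y z => ?_) c h
  simp only [smul_apply_apply, map_smul, euclCochain_comp_self, smul_zero, add_zero]

theorem deformedBracket_apply (ε : ℂ) (x y : EuclAlg n) :
    deformedBracket n ε x y = ⁅x, y⁆ + ε • euclCochain n x y := rfl

theorem isLieBracket_deformedBracket (ε : ℂ) : IsLieBracket (deformedBracket n ε) where
  alternating x := by rw [deformedBracket_apply, lie_self, twoCochain_alt, smul_zero, add_zero]
  jacobi x y z := by
    have h1 := lie_jacobi x y z
    have h2 := cocycle_cyclic euclCochain_mem_twoCocycle x y z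
    have h3 := congrArg₂ (· + ε • ·) h1 h2
    simp only [smul_zero, add_zero] at h3
    rw [← h3]
    simp only [deformedBracket_apply, map_add, map_smul, smul_add,
      euclCochain_comp_self, smul_zero, add_zero]
    abel

/-- The block matrix with rows `(0, -s uᵀ)` and `(s u, A)`, for `x = (u, A)` in `𝔢ₙ`. -/
def bordered (s : ℂ) (x : EuclAlg n) : OrthAlg (n + 1) :=
  ⟨Matrix.of (Fin.cons (Fin.cons 0 fun j => -(s * transCoord n x.left j))
      fun i => Fin.cons (s * transCoord n x.left i) (x.right.1 i)), by
    rw [LieAlgebra.Orthogonal.mem_so]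
    ext i j
    refine Fin.cases ?_ (fun i => ?_) i <;> refine Fin.cases ?_ (fun j => ?_) j
    · simp
    · simp
    · simp
    · simpa using x.right.apply_swap i j⟩

theorem bordered_zero_succ (s : ℂ) (x : EuclAlg n) (j : Fin n) :
    (bordered s x).1 0 j.succ = -(s * transCoord n x.left j) := rfl

theorem bordered_succ_zero (s : ℂ) (x : EuclAlg n) (i : Fin n) :
    (bordered s x).1 i.succ 0 = s * transCoord n x.left i := rfl

theorem bordered_succ_succ (s : ℂ) (x : EuclAlg n) (i j : Fin n) :
    (bordered s x).1 i.succ j.succ = x.right.1 i j := rfl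

/-- A skew-symmetric matrix is determined by its first column and its lower right block. -/
theorem OrthAlg.ext_succ {A B : OrthAlg (n + 1)} (h₀ : ∀ i : Fin n, A.1 i.succ 0 = B.1 i.succ 0)
    (h : ∀ i j : Fin n, A.1 i.succ j.succ = B.1 i.succ j.succ) : A = B := by
  ext i j
  refine Fin.cases ?_ (fun i => ?_) i <;> refine Fin.cases ?_ (fun j => ?_) j
  · exact (A.apply_self 0).trans (B.apply_self 0).symm
  · exact (A.apply_swap _ _).trans ((congrArg _ (h₀ j)).trans (B.apply_swap _ _).symm)
  · exact h₀ i
  · exact h i j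

/-- `bordered s` as a linear isomorphism. -/
def borderedEquiv {s : ℂ} (hs : s ≠ 0) : EuclAlg n ≃ₗ[ℂ] OrthAlg (n + 1) where
  toFun := bordered s
  map_add' x y := OrthAlg.ext_succ (fun i => mul_add s _ _) (fun i j => rfl)
  map_smul' t x := OrthAlg.ext_succ (fun i => mul_left_comm s t _) (fun i j => rfl)
  invFun B := ⟨(transCoord n).symm fun i => s⁻¹ * B.1 i.succ 0,
    ⟨B.1.submatrix Fin.succ Fin.succ, by
      rw [LieAlgebra.Orthogonal.mem_so]
      ext i j
      exact B.apply_swap i.succ j.succ⟩⟩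
  left_inv x := LieAlgebra.SemiDirectSum.ext
    (funext fun i => inv_mul_cancel_left₀ hs (transCoord n x.left i)) rfl
  right_inv B := OrthAlg.ext_succ (fun i => mul_inv_cancel_left₀ hs _) (fun i j => rfl)

/-- The lower right block of the commutator of bordered matrices picks up `s²` times `wedge`. -/
theorem bordered_deformedBracket {ε s : ℂ} (hs : s * s = ε) (x y : EuclAlg n) :
    bordered s (deformedBracket n ε x y) = ⁅bordered s x, bordered s y⁆ := by
  subst hs
  have hr : (deformedBracket n (s * s) x y).right =
      ⁅x.right, y.right⁆ + (s * s) • wedge n x.left y.left := rfl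
  have hl : (deformedBracket n (s * s) x y).left =
      rotationAction n x.right y.left - rotationAction n y.right x.left := by
    rw [deformedBracket_apply, euclCochain_apply, ← EuclAlg.lie_left, ← map_smul]
    exact add_zero _
  refine OrthAlg.ext_succ (fun i => ?_) (fun i j => ?_)
  · rw [OrthAlg.lie_apply, Fin.sum_univ_succ, Fin.sum_univ_succ]
    simp only [bordered_succ_zero, bordered_succ_succ, OrthAlg.apply_self, hl, map_sub,
      Pi.sub_apply, transCoord_rotationAction, Matrix.mulVec, dotProduct, mul_zero, zero_add,
      mul_sub, Finset.mul_sum, mul_left_comm s]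
  · rw [OrthAlg.lie_apply, Fin.sum_univ_succ, Fin.sum_univ_succ]
    simp only [bordered_succ_zero, bordered_succ_succ, bordered_zero_succ, hr, OrthAlg.add_apply,
      OrthAlg.smul_apply, OrthAlg.lie_apply, wedge_apply]
    ring

theorem exists_equiv_orthAlg_succ {ε : ℂ} (hε : ε ≠ 0) :
    ∃ Φ : EuclAlg n ≃ₗ[ℂ] OrthAlg (n + 1), ∀ x y, Φ (deformedBracket n ε x y) = ⁅Φ x, Φ y⁆ := by
  obtain ⟨s, hs⟩ := IsAlgClosed.exists_pow_nat_eq ε (n := 2) two_pos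
  rw [pow_two] at hs
  exact ⟨borderedEquiv (left_ne_zero_of_mul (hs.trans_ne hε)), bordered_deformedBracket hs⟩

end Deformed

end

theorem lemma2p1 (n : ℕ) (hn : 3 ≤ n) :
    (IsTransCocycle (rotCocycle n) ∧ IsRotInvariant (rotCocycle n) ∧
      ¬ IsTransCoboundary (rotCocycle n) ∧
      ∀ f : TransAlg n →ₗ[ℂ] TransAlg n →ₗ[ℂ] EuclAlg n, IsTransCocycle f → IsRotInvariant f →
        ∃ c : ℂ, IsTransCoboundary (f - c • rotCocycle n)) ∧
    (∃ hF : euclCochain n ∈ twoCocycle ℂ (EuclAlg n) (EuclAlg n),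
      Module.finrank ℂ (LieH2 ℂ (EuclAlg n) (EuclAlg n)) = 1 ∧
      Submodule.span ℂ {(twoCoboundary ℂ (EuclAlg n) (EuclAlg n)).mkQ ⟨euclCochain n, hF⟩} = ⊤) ∧
    (∀ c : twoCocycle ℂ (EuclAlg n) (EuclAlg n), IsIntegrable c) ∧
    (∀ ε : ℂ, IsLieBracket (deformedBracket n ε)) ∧
    (∀ ε : ℂ, ε ≠ 0 → ∃ Φ : EuclAlg n ≃ₗ[ℂ] OrthAlg (n + 1),
      ∀ x y, Φ (deformedBracket n ε x y) = ⁅Φ x, Φ y⁆) := by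
  have h2 : 2 ≤ n := by omega
  exact ⟨⟨isTransCocycle_rotCocycle, isRotInvariant_rotCocycle,
      not_isTransCoboundary_rotCocycle h2, fun f hf => hf.exists_isTransCoboundary_sub h2⟩,
    ⟨euclCochain_mem_twoCocycle,
      finrank_lieH2_eq_one (not_mem_twoCoboundary_euclCochain h2) (exists_cocycle_eq hn),
      span_mkQ_twoCocycle (exists_cocycle_eq hn)⟩,
    isIntegrable_euclAlg hn, isLieBracket_deformedBracket, fun _ => exists_equiv_orthAlg_succ⟩
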